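/- **Conventions.** A *monoidal abelian groupoid* is a monoidal category $\mathcal G=(\mathcal G,\otimes,\mathrm I,\boldsymbol a,\boldsymbol l,\boldsymbol r)$ in which every arrow is invertible and every group $\mathrm{Aut}_{\mathcal G}(X)$ is abelian; $XY$ means $X\otimes Y$, and $M(\mathcal G)$ is the monoid of isomorphism classes of objects of $\mathcal G$, with $[X][Y]=[XY]$. Monoidal functors are strong (their structure maps are isomorphisms), and isomorphisms between them are monoidal natural isomorphisms. For a monoid $M$, a *$\mathbb DM$-module* $(\mathbb A,\Theta)$ consists of abelian groups $A_a$ ($a\in M$, written multiplicatively) and homomorphisms $a_*:A_b\to A_{ab}$, $b^*:A_a\to A_{ab}$ ($a,b\in M$) such that $(ab)_*=a_*b_*$, $c^*a_*=a_*c^*$, $c^*b^*=(bc)^*$ and $1_*=\mathrm{id}=1^*$. For $n\ge 1$ let $C^n(M,(\mathbb A,\Theta))$ be the group of families $\lambda_{a_1,\dots,a_n}\in A_{a_1\cdots a_n}$ that are $1$ whenever some $a_i=1$, with $$(\partial^n\lambda)_{a_1,\dots,a_{n+1}}=(a_1)_*(\lambda_{a_2,\dots,a_{n+1}})\cdot\prod_{i=1}^{n}\lambda_{a_1,\dots,a_ia_{i+1},\dots,a_{n+1}}^{(-1)^i}\cdot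 a_{n+1}^*(\lambda_{a_1,\dots,a_n})^{(-1)^{n+1}};$$ for $n\ge2$, $\mathrm H^n(M,(\mathbb A,\Theta))=\ker\partial^n/\mathrm{im}\,\partial^{n-1}$ is the $n$-th Leech cohomology group, and $\mathrm Z^3=\ker\partial^3$. For a monoid homomorphism $p:M\to M'$ and a $\mathbb DM'$-module $(\mathbb A',\Theta')$, $p^*(\mathbb A',\Theta')$ is the $\mathbb DM$-module with groups $A'_{p(a)}$ and homomorphisms $p(a)_*$, $p(b)^*$. A morphism $(p,\mathbf q):(M,(\mathbb A,\Theta))\to(M',(\mathbb A',\Theta'))$ is a monoid homomorphism $p:M\to M'$ with a family of homomorphisms $q_a:A_a\to A'_{p(a)}$ satisfying $q_{ab}a_*=p(a)_*q_b$ and $q_{ab}b^*=p(b)^*q_a$; it induces $$\mathrm H^n(M,(\mathbb A,\Theta))\xrightarrow{\ \mathbf q_*\ }\mathrm H^n(M,p^*(\mathbb A',\Theta'))\xleftarrow{\ p^*\ }\mathrm H^n(M',(\mathbb A',\Theta')).$$ $\mathcal G$ is *of type $(M,(\mathbb A,\Theta))$* if there are given an isomorphism of monoids $i:M\cong M(\mathcal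 G)$ and group isomorphisms $j_X:A_a\cong\mathrm{Aut}_{\mathcal G}(X)$ ($a\in M$, $X\in i(a)$) such that $j_Y(g)=h\circ j_X(g)\circ h^{-1}$ for every arrow $h:X\to Y$ between objects of $i(a)$ and $g\in A_a$, and $j_{XY}(a_*(f))=1_X\otimes j_Y(f)$, $j_{XY}(b^*(g))=j_X(g)\otimes 1_Y$ for $X\in i(a)$, $Y\in i(b)$, $f\in A_b$, $g\in A_a$. If $\mathcal G$, $\mathcal G'$ are of types $(M,(\mathbb A,\Theta))$, $(M',(\mathbb A',\Theta'))$ via $(i,\mathbf j)$, $(i',\mathbf j')$, a monoidal functor $F:\mathcal G\to\mathcal G'$ is *of type $(p,\mathbf q)$* if for all $a\in M$, $X\in i(a)$ and $g\in A_a$ one has $FX\in i'(p(a))$ and $j'_{FX}(q_a(g))=F(j_X(g))$. $\mathbf{MonAbGpd}(M,(\mathbb A,\Theta))$ is the set of equivalence classes $[\mathcal G,i,\mathbf j]$ of monoidal abelian groupoids of type $(M,(\mathbb A,\Theta))$, two of them being equivalent if there is a monoidal equivalence of type $(1,\mathbf 1)$ between them. Let $\mathcal G$ be a monoidal abelian groupoid.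 Choose an object $X_a\in a$ for each $a\in M(\mathcal G)$, with $X_1=\mathrm I$, and isomorphisms $\Gamma_{a,b}:X_aX_b\to X_{ab}$ with $\Gamma_{1,a}=\boldsymbol l_{X_a}$ and $\Gamma_{a,1}=\boldsymbol r_{X_a}$. Let $(\mathbb A(\mathcal G),\Theta(\mathcal G))$ be the $\mathbb DM(\mathcal G)$-module with groups $\mathrm{Aut}(X_a)$ and $a_*(f)=\Gamma_{a,b}(1\otimes f)\Gamma_{a,b}^{-1}$, $b^*(g)=\Gamma_{a,b}(g\otimes1)\Gamma_{a,b}^{-1}$, and let $\lambda(\mathcal G)$ be its $3$-cocycle determined by $\lambda_{a,b,c}\circ\Gamma_{ab,c}\circ(\Gamma_{a,b}\otimes1)=\Gamma_{a,bc}\circ(1\otimes\Gamma_{b,c})\circ\boldsymbol a$. If $\mathcal G$ is of type $(M,(\mathbb A,\Theta))$ via $(i,\mathbf j)$, put $c(\mathcal G)=\mathbf j_*^{-1}i^*[\lambda(\mathcal G)]\in\mathrm H^3(M,(\mathbb A,\Theta))$. For $\lambda\in\mathrm Z^3(M,(\mathbb A,\Theta))$ let $\Sigma(M,\mathbb A,\Theta,\lambda)$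 be the monoidal abelian groupoid whose objects are the elements of $M$, with $\mathrm{Hom}(a,a)=A_a$, $\mathrm{Hom}(a,b)=\emptyset$ for $a\ne b$, composition the multiplication of $A_a$, $(g:a\to a)\otimes(f:b\to b)=a_*(f)\,b^*(g):ab\to ab$, associativity constraint $\lambda$, unit object $1$ and identity unit constraints; it is of type $(M,(\mathbb A,\Theta))$ in the obvious way. **Theorem.** (i) For every monoidal abelian groupoid $\mathcal G$ there are a monoid $M$ and a $\mathbb DM$-module $(\mathbb A,\Theta)$ such that $\mathcal G$ is of type $(M,(\mathbb A,\Theta))$. (ii) For every monoid $M$ and every $\mathbb DM$-module $(\mathbb A,\Theta)$, the assignment $[\mathcal G,i,\mathbf j]\mapsto c(\mathcal G)$ is well defined, independent of the choices made, and is a bijection $$\mathbf{MonAbGpd}(M,(\mathbb A,\Theta))\cong\mathrm H^3(M,(\mathbb A,\Theta)),$$ whose inverse is $[\lambda]\mapsto[\Sigma(M,\mathbb A,\Theta,\lambda)]$. (iii) If monoidal abelian groupoids $\mathcal G$ and $\mathcal G'$ are of types $(M,(\mathbb A,\Theta))$ and $(M',(\mathbb A',\Theta'))$, then for every monoidal functor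 $F:\mathcal G\to\mathcal G'$ there is a morphism $(p,\mathbf q):(M,(\mathbb A,\Theta))\to(M',(\mathbb A',\Theta'))$ such that $F$ is of type $(p,\mathbf q)$. (iv) If $\mathcal G$ and $\mathcal G'$ are of types $(M,(\mathbb A,\Theta))$ and $(M',(\mathbb A',\Theta'))$ and $(p,\mathbf q):(M,(\mathbb A,\Theta))\to(M',(\mathbb A',\Theta'))$ is a morphism, then there is a monoidal functor $F:\mathcal G\to\mathcal G'$ of type $(p,\mathbf q)$ if and only if $$p^*(c(\mathcal G'))=\mathbf q_*(c(\mathcal G))\in\mathrm H^3(M,p^*(\mathbb A',\Theta')).$$ In that case the isomorphism classes of monoidal functors $\mathcal G\to\mathcal G'$ of type $(p,\mathbf q)$ are in bijection with the elements of $\mathrm H^2(M,p^*(\mathbb A',\Theta'))$. -/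

import Mathlib

open CategoryTheory MonoidalCategory

universe u v u' v'

namespace Leech

/-! ### Coefficient systems on a monoid -/

/-- Transport of elements of a family of groups along an equality of indices. -/
def tr {M : Type u} (A : M → Type v) [∀ a, CommGroup (A a)] {a b : M} (h : a = b) :
    A a →* A b where
  toFun x := h ▸ x
  map_one' := by subst h; rfl
  map_mul' x y := by subst h; rfl

section tr
variable {M : Type u} (A : M → Type v) [∀ a, CommGroup (A a)]

@[simp] theorem tr_self {a : M} (h : a = a) (x : A a) : tr A h x = x := rfl

@[simp] theorem tr_tr {a b c : M} (h : a = b) (k : b = c) (x : A a) :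
    tr A k (tr A h x) = tr A (h.trans k) x := by
  subst h k; rfl

end tr

/-- A `𝔻M`-module: a family of abelian groups `A a`, `a ∈ M`, written multiplicatively, with
homomorphisms `a_* : A b → A (a * b)` (here `push a b`) and `b^* : A a → A (a * b)`
(here `pull a b`) such that `(ab)_* = a_* b_*`, `c^* a_* = a_* c^*`, `c^* b^* = (bc)^*` and
`1_* = 1 = 1^*`. This is the same as a functor to abelian groups from the category `𝔻M` with
objects `a ∈ M` and arrows `(a, b, c) : b ⟶ abc`, which acts on the arrow `(a, b, c)` by
`a_* c^*`. -/
structure DModule (M : Type u) [Monoid M] where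
  A : M → Type v
  [grp : ∀ a, CommGroup (A a)]
  push : ∀ a b : M, A b →* A (a * b)
  pull : ∀ a b : M, A a →* A (a * b)
  push_push : ∀ (a b c : M) (f : A c),
    push a (b * c) (push b c f) = tr A (mul_assoc a b c) (push (a * b) c f)
  push_pull : ∀ (a b c : M) (g : A b),
    push a (b * c) (pull b c g) = tr A (mul_assoc a b c) (pull (a * b) c (push a b g))
  pull_pull : ∀ (a b c : M) (h : A a),
    pull a (b * c) h = tr A (mul_assoc a b c) (pull (a * b) c (pull a b h))
  push_one : ∀ (a : M) (f : A a), push 1 a f = tr A (one_mul a).symm f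
  pull_one : ∀ (a : M) (f : A a), pull a 1 f = tr A (mul_one a).symm f

attribute [instance] DModule.grp

namespace DModule

section
variable {M : Type u} [Monoid M] (D : DModule.{u, v} M)

theorem push_tr (a : M) {b b' : M} (h : b = b') (x : D.A b) :
    D.push a b' (tr D.A h x) = tr D.A (congrArg (a * ·) h) (D.push a b x) := by
  subst h; rfl

theorem pull_tr {a a' : M} (b : M) (h : a = a') (x : D.A a) :
    D.pull a' b (tr D.A h x) = tr D.A (congrArg (· * b) h) (D.pull a b x) := by
  subst h; rfl

theorem push_congr {a a' : M} (b : M) (h : a = a') (x : D.A b) :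
    D.push a' b x = tr D.A (congrArg (· * b) h) (D.push a b x) := by
  subst h; rfl

theorem pull_congr (a : M) {b b' : M} (h : b = b') (x : D.A a) :
    D.pull a b' x = tr D.A (congrArg (a * ·) h) (D.pull a b x) := by
  subst h; rfl

end

/-- A morphism of `𝔻M`-modules. -/
structure Hom {M : Type u} [Monoid M] (D : DModule.{u, v} M) (E : DModule.{u, v'} M) where
  app : ∀ a, D.A a →* E.A a
  app_push : ∀ (a b : M) (f : D.A b), app (a * b) (D.push a b f) = E.push a b (app b f)
  app_pull : ∀ (a b : M) (g : D.A a), app (a * b) (D.pull a b g) = E.pull a b (app a g)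

theorem Hom.app_tr {M : Type u} [Monoid M] {D : DModule.{u, v} M} {E : DModule.{u, v'} M}
    (q : Hom D E) {a b : M} (h : a = b) (x : D.A a) :
    q.app b (tr D.A h x) = tr E.A h (q.app a x) := by
  subst h; rfl

theorem comap_tr {M : Type u} {M' : Type u'} (A : M' → Type v) [∀ a, CommGroup (A a)]
    (p : M → M') {a b : M} (h : a = b) (x : A (p a)) :
    tr (fun a => A (p a)) h x = tr A (congrArg p h) x := by
  subst h; rfl

/-- The restriction `p^* D` of a module along a monoid homomorphism `p : M → M'`, with
`(p^* D)_a = D_{p a}`. -/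
def comap {M : Type u} [Monoid M] {M' : Type u'} [Monoid M'] (D : DModule.{u', v} M')
    (p : M →* M') : DModule.{u, v} M where
  A a := D.A (p a)
  push a b := (tr D.A (map_mul p a b).symm).comp (D.push (p a) (p b))
  pull a b := (tr D.A (map_mul p a b).symm).comp (D.pull (p a) (p b))
  push_push a b c f := by
    simp only [MonoidHom.comp_apply, push_tr, comap_tr, tr_tr]
    rw [D.push_push, D.push_congr (p c) (map_mul p a b).symm, tr_tr, tr_tr]
  push_pull a b c g := by
    simp only [MonoidHom.comp_apply, push_tr, pull_tr, comap_tr, tr_tr]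
    rw [D.push_pull, tr_tr]
  pull_pull a b c h := by
    simp only [MonoidHom.comp_apply, pull_tr, comap_tr, tr_tr]
    rw [D.pull_congr (p a) (map_mul p b c).symm, D.pull_pull, tr_tr, tr_tr]
  push_one a f := by
    simp only [MonoidHom.comp_apply, comap_tr]
    rw [D.push_congr (p a) (map_one p).symm, D.push_one, tr_tr, tr_tr]
  pull_one a f := by
    simp only [MonoidHom.comp_apply, comap_tr]
    rw [D.pull_congr (p a) (map_one p).symm, D.pull_one, tr_tr, tr_tr]

/-! ### Leech cohomology in degrees two and three -/

section cohomology
variable {M : Type u} [Monoid M] (D : DModule.{u, v} M)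

/-- `(∂¹δ)_{a,b} = a_*(δ_b) δ_{ab}⁻¹ b^*(δ_a)`. -/
def d₁ : (∀ a, D.A a) →* (∀ a b, D.A (a * b)) where
  toFun δ a b := D.push a b (δ b) * (δ (a * b))⁻¹ * D.pull a b (δ a)
  map_one' := by ext; simp
  map_mul' δ ε := by
    funext a b
    simp only [Pi.mul_apply, map_mul, mul_inv]
    ac_rfl

/-- `(∂²φ)_{a,b,c} = a_*(φ_{b,c}) φ_{ab,c}⁻¹ φ_{a,bc} c^*(φ_{a,b})⁻¹`. -/
def d₂ : (∀ a b, D.A (a * b)) →* (∀ a b c, D.A (a * b * c)) where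
  toFun φ a b c :=
    tr D.A (mul_assoc a b c).symm (D.push a (b * c) (φ b c)) * (φ (a * b) c)⁻¹ *
      tr D.A (mul_assoc a b c).symm (φ a (b * c)) * (D.pull (a * b) c (φ a b))⁻¹
  map_one' := by ext; simp
  map_mul' φ ψ := by
    funext a b c
    simp only [Pi.mul_apply, map_mul, mul_inv]
    ac_rfl

/-- `(∂³l)_{a,b,c,d} = a_*(l_{b,c,d}) l_{ab,c,d}⁻¹ l_{a,bc,d} l_{a,b,cd}⁻¹ d^*(l_{a,b,c})`. -/
def d₃ : (∀ a b c, D.A (a * b * c)) →* (∀ a b c d, D.A (a * b * c * d)) where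
  toFun l a b c d :=
    tr D.A (by simp only [mul_assoc]) (D.push a (b * c * d) (l b c d)) * (l (a * b) c d)⁻¹ *
      tr D.A (by simp only [mul_assoc]) (l a (b * c) d) *
      (tr D.A (by simp only [mul_assoc]) (l a b (c * d)))⁻¹ * D.pull (a * b * c) d (l a b c)
  map_one' := by ext; simp
  map_mul' φ ψ := by
    funext a b c d
    simp only [Pi.mul_apply, map_mul, mul_inv]
    ac_rfl

/-- Normalized 1-cochains. -/
def C₁ : Subgroup (∀ a, D.A a) where
  carrier := {δ | δ 1 = 1}
  one_mem' := by simp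
  mul_mem' {x y} hx hy := by simp_all
  inv_mem' {x} hx := by simp_all

/-- Normalized 2-cochains. -/
def C₂ : Subgroup (∀ a b, D.A (a * b)) where
  carrier := {φ | ∀ a b, a = 1 ∨ b = 1 → φ a b = 1}
  one_mem' := by simp
  mul_mem' {x y} hx hy := fun a b h => by simp [hx a b h, hy a b h]
  inv_mem' {x} hx := fun a b h => by simp [hx a b h]

/-- Normalized 3-cochains. -/
def C₃ : Subgroup (∀ a b c, D.A (a * b * c)) where
  carrier := {l | ∀ a b c, a = 1 ∨ b = 1 ∨ c = 1 → l a b c = 1}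
  one_mem' := by simp
  mul_mem' {x y} hx hy := fun a b c h => by simp [hx a b c h, hy a b c h]
  inv_mem' {x} hx := fun a b c h => by simp [hx a b c h]

/-- 2-cocycles. -/
def Z₂ : Subgroup (∀ a b, D.A (a * b)) := D.C₂ ⊓ D.d₂.ker

/-- 2-coboundaries. -/
def B₂ : Subgroup (∀ a b, D.A (a * b)) := D.C₁.map D.d₁

/-- 3-cocycles. -/
def Z₃ : Subgroup (∀ a b c, D.A (a * b * c)) := D.C₃ ⊓ D.d₃.ker

/-- 3-coboundaries. -/
def B₃ : Subgroup (∀ a b c, D.A (a * b * c)) := D.C₂.map D.d₂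

/-- The second Leech cohomology group `H²(M, D)`. -/
abbrev H₂ : Type (max u v) := D.Z₂ ⧸ D.B₂.subgroupOf D.Z₂

/-- The third Leech cohomology group `H³(M, D)`. -/
abbrev H₃ : Type (max u v) := D.Z₃ ⧸ D.B₃.subgroupOf D.Z₃

end cohomology

section functoriality

section
variable {M : Type u} [Monoid M] {D : DModule.{u, v} M} {E : DModule.{u, v'} M} (q : Hom D E)

/-- `q_*` on 2-cochains. -/
def Hom.on₂ : (∀ a b, D.A (a * b)) →* (∀ a b, E.A (a * b)) where
  toFun φ a b := q.app _ (φ a b)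
  map_one' := by ext; simp
  map_mul' φ ψ := by ext; simp

/-- `q_*` on 3-cochains. -/
def Hom.on₃ : (∀ a b c, D.A (a * b * c)) →* (∀ a b c, E.A (a * b * c)) where
  toFun l a b c := q.app _ (l a b c)
  map_one' := by ext; simp
  map_mul' φ ψ := by ext; simp

theorem Hom.d₂_on₂ (φ : ∀ a b, D.A (a * b)) : E.d₂ (q.on₂ φ) = q.on₃ (D.d₂ φ) := by
  funext a b c
  simp [d₂, Hom.on₂, Hom.on₃, q.app_tr, q.app_push, q.app_pull]

theorem Hom.d₃_on₃ (l : ∀ a b c, D.A (a * b * c)) (a b c d : M) :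
    E.d₃ (q.on₃ l) a b c d = q.app _ (D.d₃ l a b c d) := by
  simp [d₃, Hom.on₃, q.app_tr, q.app_push, q.app_pull]

theorem Hom.on₃_mem {l : ∀ a b c, D.A (a * b * c)} (hl : l ∈ D.Z₃) : q.on₃ l ∈ E.Z₃ := by
  refine ⟨fun a b c h => ?_, ?_⟩
  · simp [Hom.on₃, hl.1 a b c h]
  · have h2 : D.d₃ l = 1 := hl.2
    change E.d₃ (q.on₃ l) = 1
    funext a b c d
    rw [q.d₃_on₃, h2]
    simp

theorem Hom.on₃_mem_B₃ {l : ∀ a b c, D.A (a * b * c)} (hl : l ∈ D.B₃) : q.on₃ l ∈ E.B₃ := by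
  obtain ⟨φ, hφ, rfl⟩ := hl
  refine ⟨q.on₂ φ, fun a b h => ?_, q.d₂_on₂ φ⟩
  simp [Hom.on₂, hφ a b h]

end

section
variable {M : Type u} [Monoid M] {M' : Type u'} [Monoid M'] (D : DModule.{u', v} M')
    (p : M →* M')

theorem cochain₂_congr (φ : ∀ a b, D.A (a * b)) {a a' b b' : M'} (ha : a = a') (hb : b = b') :
    φ a' b' = tr D.A (by rw [ha, hb]) (φ a b) := by
  subst ha hb; rfl

theorem cochain₃_congr (l : ∀ a b c, D.A (a * b * c)) {a a' b b' c c' : M'}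
    (ha : a = a') (hb : b = b') (hc : c = c') :
    l a' b' c' = tr D.A (by rw [ha, hb, hc]) (l a b c) := by
  subst ha hb hc; rfl

/-- `p^*` on 2-cochains. -/
def comap₂ : (∀ a b, D.A (a * b)) →* (∀ a b, (D.comap p).A (a * b)) where
  toFun φ a b := tr D.A (map_mul p a b).symm (φ (p a) (p b))
  map_one' := by funext a b; exact map_one (tr D.A _)
  map_mul' φ ψ := by funext a b; exact map_mul (tr D.A _) _ _

/-- `p^*` on 3-cochains. -/
def comap₃ : (∀ a b c, D.A (a * b * c)) →* (∀ a b c, (D.comap p).A (a * b * c)) where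
  toFun l a b c := tr D.A (by simp only [map_mul]) (l (p a) (p b) (p c))
  map_one' := by funext a b c; exact map_one (tr D.A _)
  map_mul' φ ψ := by funext a b c; exact map_mul (tr D.A _) _ _

theorem d₂_comap₂ (φ : ∀ a b, D.A (a * b)) :
    (D.comap p).d₂ (D.comap₂ p φ) = D.comap₃ p (D.d₂ φ) := by
  funext a b c
  change tr (fun a => D.A (p a)) _ (tr D.A _ (D.push (p a) (p (b * c)) (tr D.A _ (φ (p b) (p c)))))
    * (tr D.A _ (φ (p (a * b)) (p c)))⁻¹
    * tr (fun a => D.A (p a)) _ (tr D.A _ (φ (p a) (p (b * c))))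
    * (tr D.A _ (D.pull (p (a * b)) (p c) (tr D.A _ (φ (p a) (p b)))))⁻¹ =
    tr D.A _ (tr D.A _ (D.push (p a) (p b * p c) (φ (p b) (p c)))
    * (φ (p a * p b) (p c))⁻¹ * tr D.A _ (φ (p a) (p b * p c))
    * (D.pull (p a * p b) (p c) (φ (p a) (p b)))⁻¹)
  rw [D.cochain₂_congr φ (map_mul p a b).symm (rfl : p c = p c),
    D.cochain₂_congr φ (rfl : p a = p a) (map_mul p b c).symm]
  simp only [map_mul, map_inv, comap_tr, tr_tr, push_tr, pull_tr]

theorem d₃_comap₃ (l : ∀ a b c, D.A (a * b * c)) (a b c d : M) :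
    (D.comap p).d₃ (D.comap₃ p l) a b c d =
      tr D.A (by simp only [map_mul]) (D.d₃ l (p a) (p b) (p c) (p d)) := by
  change tr (fun a => D.A (p a)) _
        (tr D.A _ (D.push (p a) (p (b * c * d)) (tr D.A _ (l (p b) (p c) (p d)))))
    * (tr D.A _ (l (p (a * b)) (p c) (p d)))⁻¹
    * tr (fun a => D.A (p a)) _ (tr D.A _ (l (p a) (p (b * c)) (p d)))
    * (tr (fun a => D.A (p a)) _ (tr D.A _ (l (p a) (p b) (p (c * d)))))⁻¹
    * tr D.A _ (D.pull (p (a * b * c)) (p d) (tr D.A _ (l (p a) (p b) (p c)))) =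
    tr D.A _ (tr D.A _ (D.push (p a) (p b * p c * p d) (l (p b) (p c) (p d)))
    * (l (p a * p b) (p c) (p d))⁻¹ * tr D.A _ (l (p a) (p b * p c) (p d))
    * (tr D.A _ (l (p a) (p b) (p c * p d)))⁻¹
    * D.pull (p a * p b * p c) (p d) (l (p a) (p b) (p c)))
  rw [D.cochain₃_congr l (map_mul p a b).symm (rfl : p c = p c) (rfl : p d = p d),
    D.cochain₃_congr l (rfl : p a = p a) (map_mul p b c).symm (rfl : p d = p d),
    D.cochain₃_congr l (rfl : p a = p a) (rfl : p b = p b) (map_mul p c d).symm]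
  simp only [map_mul, map_inv, comap_tr, tr_tr, push_tr, pull_tr]

theorem comap₃_mem {l : ∀ a b c, D.A (a * b * c)} (hl : l ∈ D.Z₃) :
    D.comap₃ p l ∈ (D.comap p).Z₃ := by
  refine ⟨fun a b c h => ?_, ?_⟩
  · have h1 : l (p a) (p b) (p c) = 1 :=
      hl.1 _ _ _ (h.imp (fun h => by rw [h, map_one])
        (Or.imp (fun h => by rw [h, map_one]) (fun h => by rw [h, map_one])))
    change tr D.A _ (l (p a) (p b) (p c)) = 1
    rw [h1, map_one]
  · have h2 : D.d₃ l = 1 := hl.2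
    change (D.comap p).d₃ (D.comap₃ p l) = 1
    funext a b c d
    rw [D.d₃_comap₃ p, h2]
    exact map_one (tr D.A _)

theorem comap₃_mem_B₃ {l : ∀ a b c, D.A (a * b * c)} (hl : l ∈ D.B₃) :
    D.comap₃ p l ∈ (D.comap p).B₃ := by
  obtain ⟨φ, hφ, rfl⟩ := hl
  refine ⟨D.comap₂ p φ, fun a b h => ?_, D.d₂_comap₂ p φ⟩
  have h1 : φ (p a) (p b) = 1 :=
    hφ _ _ (h.imp (fun h => by rw [h, map_one]) (fun h => by rw [h, map_one]))
  change tr D.A _ (φ (p a) (p b)) = 1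
  rw [h1, map_one]

end

/-- The homomorphism `q_* : H³(M, D) → H³(M, E)` induced by a morphism of modules,
`(q_* l)_{a,b,c} = q_{abc}(l_{a,b,c})`. -/
def H₃.map {M : Type u} [Monoid M] {D : DModule.{u, v} M} {E : DModule.{u, v'} M}
    (q : Hom D E) : D.H₃ →* E.H₃ :=
  QuotientGroup.map _ _ ((q.on₃.comp D.Z₃.subtype).codRestrict E.Z₃ (fun l => q.on₃_mem l.2))
    (fun _ hl => q.on₃_mem_B₃ hl)

/-- The homomorphism `p^* : H³(M', D) → H³(M, p^* D)`,
`(p^* l)_{a,b,c} = l_{p(a),p(b),p(c)}`. -/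
def H₃.comap {M : Type u} [Monoid M] {M' : Type u'} [Monoid M'] (D : DModule.{u', v} M')
    (p : M →* M') : D.H₃ →* (D.comap p).H₃ :=
  QuotientGroup.map _ _ (((D.comap₃ p).comp D.Z₃.subtype).codRestrict (D.comap p).Z₃
      (fun l => D.comap₃_mem p l.2))
    (fun _ hl => D.comap₃_mem_B₃ p hl)

end functoriality

end DModule

/-! ### The monoidal groupoid of a 3-cocycle -/

/-- Objects of the monoidal groupoid `Σ(M, D, l)`: the elements of `M`. -/
@[ext]
structure Sig {M : Type u} [Monoid M] (D : DModule.{u, v} M) (l : D.Z₃) : Type u where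
  pt : M

namespace Sig

variable {M : Type u} [Monoid M] {D : DModule.{u, v} M} {l : D.Z₃}

/-- Arrows of `Σ(M, D, l)`: there are none from `a` to `b` if `a ≠ b`, and the arrows from `a` to
`a` are the elements of `D.A a`. -/
@[ext]
structure Hom (X Y : Sig D l) : Type v where
  eq : X.pt = Y.pt
  val : D.A X.pt

/-- Composition is the multiplication of the groups `D.A a`. -/
instance : Category.{v} (Sig D l) where
  Hom := Hom
  id X := ⟨rfl, 1⟩
  comp f g := ⟨f.eq.trans g.eq, tr D.A f.eq.symm g.val * f.val⟩
  id_comp f := Hom.ext (by simp)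
  comp_id f := Hom.ext (by simp)
  assoc f g h := Hom.ext (by simp [mul_assoc])

theorem hom_ext {X Y : Sig D l} {f g : X ⟶ Y} (h : f.val = g.val) : f = g := Hom.ext h

@[simp] theorem id_val (X : Sig D l) : Hom.val (𝟙 X) = 1 := rfl

@[simp] theorem comp_val {X Y Z : Sig D l} (f : X ⟶ Y) (g : Y ⟶ Z) :
    (f ≫ g).val = tr D.A f.eq.symm g.val * f.val := rfl

/-- The isomorphism `X ≅ Y` given by an equality `X = Y` in `M` and an element of the group. -/
@[simps] def isoMk {X Y : Sig D l} (h : X.pt = Y.pt) (x : D.A X.pt) : X ≅ Y where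
  hom := ⟨h, x⟩
  inv := ⟨h.symm, tr D.A h x⁻¹⟩
  hom_inv_id := hom_ext (by simp)
  inv_hom_id := hom_ext (by simp)

instance : IsGroupoid (Sig D l) where
  all_isIso f := (isoMk f.eq f.val).isIso_hom

/-- The tensor product is given on objects by the multiplication of `M`, and on arrows by
`(g : a ⟶ a) ⊗ (f : b ⟶ b) = a_*(f) b^*(g)`; the associator is `l`, the unitors are identities. -/
instance : MonoidalCategoryStruct (Sig D l) where
  tensorObj X Y := ⟨X.pt * Y.pt⟩
  tensorUnit := ⟨1⟩
  tensorHom g f :=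
    ⟨congrArg₂ (· * ·) g.eq f.eq, D.push _ _ f.val * D.pull _ _ g.val⟩
  whiskerLeft X _ _ f := ⟨congrArg (X.pt * ·) f.eq, D.push X.pt _ f.val⟩
  whiskerRight g Y := ⟨congrArg (· * Y.pt) g.eq, D.pull _ Y.pt g.val⟩
  associator X Y Z := isoMk (mul_assoc _ _ _) (l.1 X.pt Y.pt Z.pt)
  leftUnitor _ := isoMk (one_mul _) 1
  rightUnitor _ := isoMk (mul_one _) 1

theorem tensorObj_pt (X Y : Sig D l) : (X ⊗ Y).pt = X.pt * Y.pt := rfl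

theorem tensorHom_val {X Y X' Y' : Sig D l} (g : X ⟶ Y) (f : X' ⟶ Y') :
    (g ⊗ₘ f).val = D.push X.pt X'.pt f.val * D.pull X.pt X'.pt g.val := rfl

theorem whiskerLeft_val (X : Sig D l) {Y Z : Sig D l} (f : Y ⟶ Z) :
    (X ◁ f).val = D.push X.pt Y.pt f.val := rfl

theorem whiskerRight_val {Y Z : Sig D l} (f : Y ⟶ Z) (X : Sig D l) :
    (f ▷ X).val = D.pull Y.pt X.pt f.val := rfl

theorem associator_val (X Y Z : Sig D l) :
    (α_ X Y Z).hom.val = l.1 X.pt Y.pt Z.pt := rfl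

theorem leftUnitor_val (X : Sig D l) : (λ_ X).hom.val = 1 := rfl

theorem rightUnitor_val (X : Sig D l) : (ρ_ X).hom.val = 1 := rfl

theorem eq_of_coboundary_eq_one {A : Type v} [CommGroup A] {p q r s t : A}
    (h : p * q⁻¹ * r * s⁻¹ * t = 1) : p * r * t = s * q := by
  have h2 : p * q⁻¹ * r * s⁻¹ * t = (p * r * t) * (s * q)⁻¹ := by
    rw [mul_inv]; ac_rfl
  rw [h2] at h
  exact mul_inv_eq_one.mp h

instance : MonoidalCategory (Sig D l) where
  tensorHom_def {X Y X' Y'} f g := hom_ext (by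
    obtain ⟨a⟩ := X; obtain ⟨b⟩ := Y; obtain ⟨a'⟩ := X'; obtain ⟨b'⟩ := Y'
    obtain ⟨h, f⟩ := f; obtain ⟨h', g⟩ := g
    cases h; cases h'; rfl)
  id_tensorHom_id X Y := hom_ext (by simp [tensorHom_val])
  tensorHom_comp_tensorHom {X Y Z X' Y' Z'} f f' g g' := hom_ext (by
    obtain ⟨a⟩ := X; obtain ⟨b⟩ := Y; obtain ⟨c⟩ := Z
    obtain ⟨a'⟩ := X'; obtain ⟨b'⟩ := Y'; obtain ⟨c'⟩ := Z'
    obtain ⟨h, f⟩ := f; obtain ⟨h', f'⟩ := f'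
    obtain ⟨k, g⟩ := g; obtain ⟨k', g'⟩ := g'
    cases h; cases h'; cases k; cases k'
    simp only [comp_val, tensorHom_val, tr_self, map_mul]
    exact mul_mul_mul_comm _ _ _ _)
  whiskerLeft_id X Y := hom_ext (by simp [whiskerLeft_val])
  id_whiskerRight X Y := hom_ext (by simp [whiskerRight_val])
  associator_naturality {X X' X'' Y Y' Y''} f g h := hom_ext (by
    obtain ⟨a⟩ := X; obtain ⟨b⟩ := Y; obtain ⟨a'⟩ := X'; obtain ⟨b'⟩ := Y'
    obtain ⟨a''⟩ := X''; obtain ⟨b''⟩ := Y''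
    obtain ⟨e, f⟩ := f; obtain ⟨e', g⟩ := g; obtain ⟨e'', h⟩ := h
    cases e; cases e'; cases e''
    simp only [comp_val, tensorHom_val, associator_val, tr_self, map_mul]
    change l.1 a a' a'' * _ = tr D.A _ (D.push a (a' * a'') (D.push a' a'' h)) *
      tr D.A _ (D.push a (a' * a'') (D.pull a' a'' g)) *
      tr D.A _ (D.pull a (a' * a'') f) * l.1 a a' a''
    rw [D.push_push, D.push_pull, D.pull_pull]
    simp only [tr_tr, tr_self]
    exact (mul_comm _ _).trans (congrArg (· * _) (mul_assoc _ _ _).symm))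
  leftUnitor_naturality {X Y} f := hom_ext (by
    obtain ⟨a⟩ := X; obtain ⟨b⟩ := Y; obtain ⟨e, f⟩ := f; cases e
    simp only [comp_val, whiskerLeft_val, leftUnitor_val, map_one, one_mul, mul_one]
    exact D.push_one a f)
  rightUnitor_naturality {X Y} f := hom_ext (by
    obtain ⟨a⟩ := X; obtain ⟨b⟩ := Y; obtain ⟨e, f⟩ := f; cases e
    simp only [comp_val, whiskerRight_val, rightUnitor_val, map_one, one_mul, mul_one]
    exact D.pull_one a f)
  pentagon W X Y Z := hom_ext (by
    obtain ⟨a⟩ := W; obtain ⟨b⟩ := X; obtain ⟨c⟩ := Y; obtain ⟨d⟩ := Z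
    simp only [comp_val, whiskerLeft_val, whiskerRight_val, associator_val]
    have h : D.d₃ l.1 a b c d = 1 := congrFun (congrFun (congrFun (congrFun l.2.2 a) b) c) d
    change tr D.A _ (tr D.A _ (D.push a (b * c * d) (l.1 b c d)) * l.1 a (b * c) d) *
      D.pull (a * b * c) d (l.1 a b c) = tr D.A _ (l.1 a b (c * d)) * l.1 (a * b) c d
    simp only [map_mul, tr_tr]
    exact eq_of_coboundary_eq_one h)
  triangle X Y := hom_ext (by
    obtain ⟨a⟩ := X; obtain ⟨b⟩ := Y
    have h : l.1 a 1 b = 1 := l.2.1 a 1 b (Or.inr (Or.inl rfl))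
    change tr D.A _ (D.push a (1 * b) 1) * l.1 a 1 b = D.pull (a * 1) b 1
    simp [h])

end Sig

/-! ### Monoidal abelian groupoids and their types -/

/-- A groupoid whose isotropy groups are all abelian. -/
class IsAbelianGroupoid (G : Type u) [Category.{v} G] : Prop extends IsGroupoid G where
  aut_comm : ∀ (X : G) (f g : Aut X), f * g = g * f

instance {M : Type u} [Monoid M] (D : DModule.{u, v} M) (l : D.Z₃) :
    IsAbelianGroupoid (Sig D l) where
  aut_comm _ _ _ := Iso.ext (Sig.hom_ext (mul_comm (G := D.A _) _ _))

section types

variable {G : Type u} [Category.{v} G] [MonoidalCategory G] {M : Type u'} [Monoid M]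

theorem toSkeleton_tensor {i : M ≃* Skeleton G} {a b : M} {X Y : G} (hX : toSkeleton X = i a)
    (hY : toSkeleton Y = i b) : toSkeleton (X ⊗ Y) = i (a * b) := by
  rw [Skeleton.toSkeleton_tensorObj, hX, hY, map_mul]

variable (G) in
/-- The data exhibiting the monoidal groupoid `G` as being of type `(M, D)`: an isomorphism `i` from
`M` to the monoid `Skeleton G` of isomorphism classes of objects of `G`, and isomorphisms
`j_X : D_a ≅ Aut X`, for `X` in the class `i a`, which are compatible with the arrows of `G` and
with the tensor product. -/
structure TypeData (D : DModule.{u', v'} M) where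
  i : M ≃* Skeleton G
  j : ∀ {a : M} {X : G}, toSkeleton X = i a → (D.A a ≃* Aut X)
  j_conj : ∀ {a : M} {X Y : G} (hX : toSkeleton X = i a) (hY : toSkeleton Y = i a) (h : X ≅ Y)
    (g : D.A a), (j hY g).hom = h.inv ≫ (j hX g).hom ≫ h.hom
  j_push : ∀ {a b : M} {X Y : G} (hX : toSkeleton X = i a) (hY : toSkeleton Y = i b) (f : D.A b),
    (j (toSkeleton_tensor hX hY) (D.push a b f)).hom = X ◁ (j hY f).hom
  j_pull : ∀ {a b : M} {X Y : G} (hX : toSkeleton X = i a) (hY : toSkeleton Y = i b) (g : D.A a),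
    (j (toSkeleton_tensor hX hY) (D.pull a b g)).hom = (j hX g).hom ▷ Y

end types

/-- A functor `F : G ⥤ G'`, between groupoids of types `(M, D)` and `(M', D')`, is of type `(p, q)`
if it carries the objects of the class `i a` to objects of the class `i' (p a)`, and
`j'_{F X} (q_a g) = F (j_X g)` for `X` in the class `i a` and `g ∈ D_a`. -/
def IsOfType {G : Type u} [Category.{v} G] [MonoidalCategory G]
    {G' : Type u'} [Category.{v'} G'] [MonoidalCategory G'] {M : Type u} [Monoid M]
    {D : DModule.{u, v} M} {M' : Type u'} [Monoid M'] {D' : DModule.{u', v'} M'} (T : TypeData G D) (T' : TypeData G' D') (p : M →* M')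
    (q : ∀ a, D.A a →* D'.A (p a)) (F : G ⥤ G') : Prop :=
  ∀ (a : M) (X : G) (hX : toSkeleton X = T.i a), ∃ hFX : toSkeleton (F.obj X) = T'.i (p a),
    ∀ g : D.A a, (T'.j hFX (q a g)).hom = F.map (T.j hX g).hom

/-- A monoidal abelian groupoid of type `(M, D)`. -/
structure MonAbGpdOfType {M : Type u} [Monoid M] (D : DModule.{u, v} M) where
  carrier : Type u
  [category : Category.{v} carrier]
  [monoidal : MonoidalCategory carrier]
  [abelian : IsAbelianGroupoid carrier]
  type : TypeData carrier D

attribute [instance] MonAbGpdOfType.category MonAbGpdOfType.monoidal MonAbGpdOfType.abelian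

namespace MonAbGpdOfType

variable {M : Type u} [Monoid M] {D : DModule.{u, v} M}

/-- Two monoidal abelian groupoids of type `(M, D)` are equivalent if there is a monoidal
equivalence of type `(1, 1)` between them. -/
def IsEquivalent (S T : MonAbGpdOfType D) : Prop :=
  ∃ (e : S.carrier ≌ T.carrier) (_ : e.functor.Monoidal) (_ : e.inverse.Monoidal),
    e.IsMonoidal ∧
      IsOfType S.type T.type (MonoidHom.id M) (fun a => MonoidHom.id (D.A a)) e.functor

instance setoid : Setoid (MonAbGpdOfType D) where
  r := IsEquivalent
  iseqv :=
    { refl S := ⟨.refl, inferInstance, inferInstance, inferInstance,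
        fun a X hX => ⟨hX, fun g => rfl⟩⟩
      symm := by
        rintro S T ⟨e, h1, h2, h3, h⟩
        refine ⟨e.symm, h2, h1, inferInstance, fun a Y hY => ?_⟩
        have hX : toSkeleton (e.inverse.obj Y) = S.type.i a := by
          obtain ⟨b, hb⟩ := S.type.i.surjective (toSkeleton (e.inverse.obj Y))
          obtain ⟨h', -⟩ := h b _ hb.symm
          have h4 : toSkeleton (e.functor.obj (e.inverse.obj Y)) = toSkeleton Y :=
            congr_toSkeleton_of_iso (e.counitIso.app Y)
          rw [h4, hY] at h'
          have := T.type.i.injective h'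
          rw [← hb, this]; rfl
        refine ⟨hX, fun g => ?_⟩
        obtain ⟨h', h5⟩ := h a _ hX
        apply e.functor.map_injective
        have h6 := T.type.j_conj hY h' (e.counitIso.app Y).symm g
        refine (h5 g).symm.trans (h6.trans ?_)
        change e.counit.app Y ≫ _ ≫ e.counitInv.app Y = e.functor.map (e.inverse.map _)
        rw [Equivalence.fun_inv_map]
      trans := by
        rintro S T U ⟨e, h1, h2, h3, h⟩ ⟨e', h1', h2', h3', h'⟩
        refine ⟨e.trans e', inferInstance, inferInstance, inferInstance, fun a X hX => ?_⟩
        obtain ⟨k, hk⟩ := h a X hX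
        obtain ⟨k', hk'⟩ := h' a _ k
        exact ⟨k', fun g => (hk' g).trans (congrArg e'.functor.map (hk g))⟩ }

end MonAbGpdOfType

/-- The set of equivalence classes of monoidal abelian groupoids of type `(M, D)`. -/
abbrev MonAbGpdClasses {M : Type u} [Monoid M] (D : DModule.{u, v} M) : Type (max (u + 1) (v + 1)) :=
  Quotient (MonAbGpdOfType.setoid (D := D))

theorem Sig.pt_eq {M : Type u} [Monoid M] {D : DModule.{u, v} M} {l : D.Z₃} {X Y : Sig D l}
    (h : toSkeleton X = toSkeleton Y) : X.pt = Y.pt :=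
  (toSkeleton_eq_toSkeleton_iff.mp h).some.hom.eq

/-- The groupoid `Σ(M, D, l)` is of type `(M, D)`: `i a` is the class of the object `a`, and `j_a` is
the identity of `D_a = Aut a`. -/
noncomputable def Sig.typeData {M : Type u} [Monoid M] (D : DModule.{u, v} M) (l : D.Z₃) :
    TypeData (Sig D l) D where
  i := MulEquiv.ofBijective
    ({ toFun := fun a => toSkeleton (⟨a⟩ : Sig D l)
       map_one' := rfl
       map_mul' := fun a b => Skeleton.toSkeleton_tensorObj (⟨a⟩ : Sig D l) ⟨b⟩ } :
      M →* Skeleton (Sig D l))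
    ⟨fun a b h => Sig.pt_eq h, fun x => Quotient.inductionOn x fun X => ⟨X.pt, rfl⟩⟩
  j {a X} hX :=
    { toFun := fun g => Sig.isoMk rfl (tr D.A (Sig.pt_eq hX).symm g)
      invFun := fun f => tr D.A (Sig.pt_eq hX) f.hom.val
      left_inv := fun g => by simp
      right_inv := fun f => Iso.ext (Sig.hom_ext (by simp))
      map_mul' := fun f g => Iso.ext (Sig.hom_ext (map_mul (tr D.A _) f g)) }
  j_conj {a X Y} hX hY h g := Sig.hom_ext (by
    obtain ⟨x⟩ := X
    obtain ⟨y⟩ := Y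
    obtain rfl : x = a := Sig.pt_eq hX
    obtain rfl : y = x := Sig.pt_eq hY
    have hh : h.hom.val * h.inv.val = 1 := congrArg Sig.Hom.val h.inv_hom_id
    change g = (h.hom.val * g) * h.inv.val
    rw [mul_right_comm, hh, one_mul])
  j_push {a b X Y} hX hY f := Sig.hom_ext (by
    obtain ⟨x⟩ := X
    obtain ⟨y⟩ := Y
    obtain rfl : x = a := Sig.pt_eq hX
    obtain rfl : y = b := Sig.pt_eq hY
    rfl)
  j_pull {a b X Y} hX hY f := Sig.hom_ext (by
    obtain ⟨x⟩ := X
    obtain ⟨y⟩ := Y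
    obtain rfl : x = a := Sig.pt_eq hX
    obtain rfl : y = b := Sig.pt_eq hY
    rfl)

/-- `Σ(M, D, l)` as a monoidal abelian groupoid of type `(M, D)`. -/
noncomputable def Sig.monAbGpd {M : Type u} [Monoid M] (D : DModule.{u, v} M) (l : D.Z₃) : MonAbGpdOfType D where
  carrier := Sig D l
  type := Sig.typeData D l

section functors

variable {G : Type u} [Category.{v} G] [MonoidalCategory G]
  {G' : Type u'} [Category.{v'} G'] [MonoidalCategory G']
  {M : Type u} [Monoid M] {D : DModule.{u, v} M}
  {M' : Type u'} [Monoid M'] {D' : DModule.{u', v'} M'}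

/-- The monoidal functors `G ⥤ G'` of type `(p, q)`. -/
structure MonFunctor (T : TypeData G D) (T' : TypeData G' D') (p : M →* M')
    (q : DModule.Hom D (D'.comap p)) where
  F : G ⥤ G'
  [monoidal : F.Monoidal]
  isOfType : IsOfType T T' p q.app F

attribute [instance] MonFunctor.monoidal

/-- Monoidal functors are isomorphic if there is a monoidal natural isomorphism between them. -/
instance MonFunctor.setoid (T : TypeData G D) (T' : TypeData G' D') (p : M →* M')
    (q : DModule.Hom D (D'.comap p)) : Setoid (MonFunctor T T' p q) where
  r K L := ∃ e : K.F ≅ L.F, NatTrans.IsMonoidal e.hom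
  iseqv :=
    { refl K := ⟨Iso.refl _, inferInstanceAs (NatTrans.IsMonoidal (𝟙 K.F))⟩
      symm := fun ⟨e, _⟩ => ⟨e.symm, inferInstanceAs (NatTrans.IsMonoidal e.inv)⟩
      trans := fun ⟨e, _⟩ ⟨e', _⟩ =>
        ⟨e ≪≫ e', inferInstanceAs (NatTrans.IsMonoidal (e.hom ≫ e'.hom))⟩ }

end functors

/-! ### The 3-cocycle of a monoidal abelian groupoid -/

section unitors

variable {G : Type u} [Category.{v} G] [MonoidalCategory G]

theorem unit_aux_left {I X : G} (h : I = 𝟙_ G) (f : X ⟶ X) :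
    I ◁ f ≫ (whiskerRightIso (eqToIso h) X ≪≫ λ_ X).hom =
      (whiskerRightIso (eqToIso h) X ≪≫ λ_ X).hom ≫ f := by
  subst h; simp

theorem unit_aux_right {I X : G} (h : I = 𝟙_ G) (f : X ⟶ X) :
    f ▷ I ≫ (whiskerLeftIso X (eqToIso h) ≪≫ ρ_ X).hom =
      (whiskerLeftIso X (eqToIso h) ≪≫ ρ_ X).hom ≫ f := by
  subst h; simp

theorem pentagon_aux {A B C D AB BC CD ABC BCD X : G} (ab : A ⊗ B ≅ AB) (bc : B ⊗ C ≅ BC)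
    (cd : C ⊗ D ≅ CD) (g1 : AB ⊗ C ≅ ABC) (g2 : A ⊗ BC ≅ ABC) (g3 : BC ⊗ D ≅ BCD)
    (g4 : B ⊗ CD ≅ BCD) (g5 : ABC ⊗ D ≅ X) (g6 : A ⊗ BCD ≅ X) (g7 : AB ⊗ CD ≅ X) :
    (g5.inv ≫ (g1.inv ≫ ab.inv ▷ C ≫ (α_ A B C).hom ≫ A ◁ bc.hom ≫ g2.hom) ▷ D ≫ g5.hom) ≫
      (g5.inv ≫ g2.inv ▷ D ≫ (α_ A BC D).hom ≫ A ◁ g3.hom ≫ g6.hom) ≫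
      (g6.inv ≫ A ◁ (g3.inv ≫ bc.inv ▷ D ≫ (α_ B C D).hom ≫ B ◁ cd.hom ≫ g4.hom) ≫ g6.hom) =
    (g5.inv ≫ g1.inv ▷ D ≫ (α_ AB C D).hom ≫ AB ◁ cd.hom ≫ g7.hom) ≫
      (g7.inv ≫ ab.inv ▷ CD ≫ (α_ A B CD).hom ≫ A ◁ g4.hom ≫ g6.hom) := by
  have h1 : AB ◁ cd.hom ≫ ab.inv ▷ CD = ab.inv ▷ (C ⊗ D) ≫ (A ⊗ B) ◁ cd.hom :=
    whisker_exchange _ _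
  have h2 : A ◁ bc.hom ▷ D ≫ A ◁ bc.inv ▷ D = 𝟙 _ := by simp [← whiskerLeft_comp]
  simp [reassoc_of% h1]

end unitors

section cleavage

variable (G : Type u) [Category.{v} G] [MonoidalCategory G]

/-- A cleavage of `G`: a representative `X_a` of each isomorphism class `a`, with `X_1 = I`, and
isomorphisms `Γ_{a,b} : X_a X_b ≅ X_{ab}` which are the unit constraints for `a = 1` or `b = 1`. -/
structure Cleavage where
  obj : Skeleton G → G
  toSkeleton_obj : ∀ a, toSkeleton (obj a) = a
  obj_one : obj 1 = 𝟙_ G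
  Γ : ∀ a b, obj a ⊗ obj b ≅ obj (a * b)
  Γ_one_left : ∀ a, Γ 1 a = whiskerRightIso (eqToIso obj_one) (obj a) ≪≫ λ_ (obj a) ≪≫
    eqToIso (congrArg obj (one_mul a).symm)
  Γ_one_right : ∀ a, Γ a 1 = whiskerLeftIso (obj a) (eqToIso obj_one) ≪≫ ρ_ (obj a) ≪≫
    eqToIso (congrArg obj (mul_one a).symm)

theorem unitors_aux {X Y : G} (hX : X = 𝟙_ G) (hY : Y = X) :
    whiskerRightIso (eqToIso hX) X ≪≫ λ_ X ≪≫ eqToIso hY.symm =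
      whiskerLeftIso X (eqToIso hX) ≪≫ ρ_ X ≪≫ eqToIso hY.symm := by
  subst hX hY
  ext
  simp [unitors_equal]

instance : Nonempty (Cleavage G) := by
  classical
  let obj : Skeleton G → G := fun a => if a = 1 then 𝟙_ G else Quotient.out a
  have hobj : ∀ a, toSkeleton (obj a) = a := fun a => by
    by_cases h : a = 1
    · subst h; simp only [obj, if_true]; rfl
    · simp only [obj, h, if_false]; exact Quotient.out_eq a
  have h1 : obj 1 = 𝟙_ G := if_pos rfl
  have hΓ : ∀ a b, Nonempty (obj a ⊗ obj b ≅ obj (a * b)) := fun a b =>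
    toSkeleton_eq_toSkeleton_iff.mp (by rw [Skeleton.toSkeleton_tensorObj, hobj, hobj, hobj])
  refine ⟨⟨obj, hobj, h1, fun a b =>
    if ha : a = 1 then
      whiskerRightIso (eqToIso (by rw [ha, h1])) (obj b) ≪≫ λ_ (obj b) ≪≫
        eqToIso (by rw [ha, one_mul])
    else if hb : b = 1 then
      whiskerLeftIso (obj a) (eqToIso (by rw [hb, h1])) ≪≫ ρ_ (obj a) ≪≫
        eqToIso (by rw [hb, mul_one])
    else (hΓ a b).some, fun a => by simp, fun a => ?_⟩⟩
  by_cases ha : a = 1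
  · subst ha
    simp only [dite_true]
    exact unitors_aux G h1 (congrArg obj (mul_one 1))
  · simp [ha]

end cleavage

section conjugation

variable {G : Type u} [Category.{v} G]

instance autCommGroup [IsAbelianGroupoid G] (X : G) : CommGroup (Aut X) where
  toGroup := inferInstance
  mul_comm := IsAbelianGroupoid.aut_comm X

/-- Two automorphisms are conjugate if they correspond to each other under some isomorphism. -/
def AutConj {X Y : G} (f : Aut X) (g : Aut Y) : Prop :=
  ∃ e : X ≅ Y, f.hom ≫ e.hom = e.hom ≫ g.hom

theorem AutConj.refl {X : G} (f : Aut X) : AutConj f f := ⟨Iso.refl X, by simp⟩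

theorem AutConj.symm {X Y : G} {f : Aut X} {g : Aut Y} : AutConj f g → AutConj g f :=
  fun ⟨e, h⟩ => ⟨e.symm, by
    change g.hom ≫ e.inv = e.inv ≫ f.hom
    rw [Iso.eq_inv_comp, ← Category.assoc, ← h, Category.assoc, e.hom_inv_id, Category.comp_id]⟩

theorem AutConj.trans {X Y Z : G} {f : Aut X} {g : Aut Y} {h : Aut Z} :
    AutConj f g → AutConj g h → AutConj f h :=
  fun ⟨e, he⟩ ⟨e', he'⟩ => ⟨e ≪≫ e', by
    change f.hom ≫ e.hom ≫ e'.hom = (e.hom ≫ e'.hom) ≫ h.hom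
    rw [← Category.assoc, he, Category.assoc, he', Category.assoc]⟩

theorem AutConj.map {G' : Type u'} [Category.{v'} G'] (F : G ⥤ G') {X Y : G} {f : Aut X} {g : Aut Y} :
    AutConj f g → AutConj (F.mapAut X f) (F.mapAut Y g) :=
  fun ⟨e, he⟩ => ⟨F.mapIso e, by
    change F.map f.hom ≫ F.map e.hom = F.map e.hom ≫ F.map g.hom
    rw [← F.map_comp, he, F.map_comp]⟩

theorem autConj_conjAut {X Y : G} (e : X ≅ Y) (f : Aut X) : AutConj (e.conjAut f) f :=
  AutConj.symm ⟨e, by rw [Iso.conjAut_hom, Iso.conj_apply, Iso.hom_inv_id_assoc]⟩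

theorem AutConj.eq [IsAbelianGroupoid G] {X : G} {f g : Aut X} : AutConj f g → f = g :=
  fun ⟨e, he⟩ => by
    let e' : Aut X := e
    have h : e' * f = g * e' := Iso.ext he
    rw [mul_comm] at h
    exact mul_right_cancel h

end conjugation

namespace Cleavage

variable {G : Type u} [Category.{v} G] [MonoidalCategory G] (K : Cleavage G)

/-- `a_*(f) : X_{ab} ⟶ X_{ab}` corresponds to `1 ⊗ f` under `Γ_{a,b}`. -/
noncomputable def push (a b : Skeleton G) : Aut (K.obj b) →* Aut (K.obj (a * b)) :=
  (K.Γ a b).conjAut.toMonoidHom.comp ((tensorLeft (K.obj a)).mapAut (K.obj b))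

/-- `b^*(g) : X_{ab} ⟶ X_{ab}` corresponds to `g ⊗ 1` under `Γ_{a,b}`. -/
noncomputable def pull (a b : Skeleton G) : Aut (K.obj a) →* Aut (K.obj (a * b)) :=
  (K.Γ a b).conjAut.toMonoidHom.comp ((tensorRight (K.obj b)).mapAut (K.obj a))

theorem autConj_push (a b : Skeleton G) (f : Aut (K.obj b)) :
    AutConj (K.push a b f) ((tensorLeft (K.obj a)).mapAut (K.obj b) f) :=
  autConj_conjAut _ _

theorem autConj_pull (a b : Skeleton G) (f : Aut (K.obj a)) :
    AutConj (K.pull a b f) ((tensorRight (K.obj b)).mapAut (K.obj a) f) :=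
  autConj_conjAut _ _

/-- `l_{a,b,c}` is the automorphism of `X_{abc}` such that
`l_{a,b,c} ∘ Γ_{ab,c} ∘ (Γ_{a,b} ⊗ 1) = Γ_{a,bc} ∘ (1 ⊗ Γ_{b,c}) ∘ α`. -/
noncomputable def lam (a b c : Skeleton G) : Aut (K.obj (a * b * c)) :=
  (K.Γ (a * b) c).symm ≪≫ whiskerRightIso (K.Γ a b).symm (K.obj c) ≪≫
    α_ (K.obj a) (K.obj b) (K.obj c) ≪≫ whiskerLeftIso (K.obj a) (K.Γ b c) ≪≫ K.Γ a (b * c) ≪≫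
      eqToIso (congrArg K.obj (mul_assoc a b c).symm)

/-- `Γ_{a,b}` with a free target. -/
noncomputable def Γ' {a b c : Skeleton G} (h : a * b = c) : K.obj a ⊗ K.obj b ≅ K.obj c :=
  K.Γ a b ≪≫ eqToIso (congrArg K.obj h)

theorem lam_aux_left {I B C E : G} (h : I = 𝟙_ G) (e : B ⊗ C ≅ E) :
    e.inv ≫ (whiskerRightIso (eqToIso h) B ≪≫ λ_ B).inv ▷ C ≫ (α_ I B C).hom ≫ I ◁ e.hom ≫
      (whiskerRightIso (eqToIso h) E ≪≫ λ_ E).hom = 𝟙 E := by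
  subst h
  simp

theorem lam_aux_mid {I B C E : G} (h : I = 𝟙_ G) (e : B ⊗ C ≅ E) :
    e.inv ≫ (whiskerLeftIso B (eqToIso h) ≪≫ ρ_ B).inv ▷ C ≫ (α_ B I C).hom ≫
      B ◁ (whiskerRightIso (eqToIso h) C ≪≫ λ_ C).hom ≫ e.hom = 𝟙 E := by
  subst h
  simp

theorem lam_aux_right {I B C E : G} (h : I = 𝟙_ G) (e : B ⊗ C ≅ E) :
    (whiskerLeftIso E (eqToIso h) ≪≫ ρ_ E).inv ≫ e.inv ▷ I ≫ (α_ B C I).hom ≫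
      B ◁ (whiskerLeftIso C (eqToIso h) ≪≫ ρ_ C).hom ≫ e.hom = 𝟙 E := by
  subst h
  simp

theorem Γ'_one_left (a : Skeleton G) :
    K.Γ' (one_mul a) = whiskerRightIso (eqToIso K.obj_one) _ ≪≫ λ_ _ := by
  rw [Γ', Γ_one_left]; ext; simp

theorem Γ'_one_right (a : Skeleton G) :
    K.Γ' (mul_one a) = whiskerLeftIso _ (eqToIso K.obj_one) ≪≫ ρ_ _ := by
  rw [Γ', Γ_one_right]; ext; simp

variable [IsAbelianGroupoid G]

theorem autConj_tr {a b : Skeleton G} (h : a = b) (f : Aut (K.obj a)) :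
    AutConj (tr (fun a => Aut (K.obj a)) h f) f := by
  subst h; exact AutConj.refl _

/-- The module `(𝔸(G), Θ(G))` over the monoid of isomorphism classes of objects of `G`, with
`𝔸(G)_a = Aut X_a`. -/
noncomputable def module : DModule.{u, v} (Skeleton G) where
  A a := Aut (K.obj a)
  push := K.push
  pull := K.pull
  push_push a b c f := by
    refine AutConj.eq ?_
    refine (K.autConj_push _ _ _).trans (.trans ?_
      ((K.autConj_push (a * b) c f).symm.trans (K.autConj_tr _ _).symm))
    refine (AutConj.map _ (K.autConj_push b c f)).trans ?_
    exact ⟨(α_ _ _ _).symm ≪≫ whiskerRightIso (K.Γ a b) _, by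
      change (K.obj a ◁ K.obj b ◁ f.hom) ≫ (α_ _ _ _).inv ≫ (K.Γ a b).hom ▷ K.obj c =
        ((α_ _ _ _).inv ≫ (K.Γ a b).hom ▷ K.obj c) ≫ K.obj (a * b) ◁ f.hom
      simp [← whisker_exchange]⟩
  push_pull a b c f := by
    refine AutConj.eq ?_
    refine (K.autConj_push _ _ _).trans (.trans ?_
      ((K.autConj_pull (a * b) c _).symm.trans (K.autConj_tr _ _).symm))
    refine (AutConj.map _ (K.autConj_pull b c f)).trans
      (.trans ?_ (AutConj.map _ (K.autConj_push a b f)).symm)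
    exact ⟨(α_ _ _ _).symm, by
      change (K.obj a ◁ (f.hom ▷ K.obj c)) ≫ (α_ _ _ _).inv =
        (α_ _ _ _).inv ≫ (K.obj a ◁ f.hom) ▷ K.obj c
      simp⟩
  pull_pull a b c f := by
    refine AutConj.eq ?_
    refine (K.autConj_pull _ _ _).trans (.trans ?_
      ((K.autConj_pull (a * b) c _).symm.trans (K.autConj_tr _ _).symm))
    refine .trans ?_ (AutConj.map _ (K.autConj_pull a b f)).symm
    exact ⟨whiskerLeftIso _ (K.Γ b c).symm ≪≫ (α_ _ _ _).symm, by
      change f.hom ▷ K.obj (b * c) ≫ K.obj a ◁ (K.Γ b c).inv ≫ (α_ _ _ _).inv =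
        (K.obj a ◁ (K.Γ b c).inv ≫ (α_ _ _ _).inv) ≫ (f.hom ▷ K.obj b) ▷ K.obj c
      simp [← whisker_exchange_assoc]⟩
  push_one a f := by
    refine AutConj.eq ((K.autConj_push _ _ _).trans (.trans ?_ (K.autConj_tr _ _).symm))
    exact ⟨_, unit_aux_left K.obj_one f.hom⟩
  pull_one a f := by
    refine AutConj.eq ((K.autConj_pull _ _ _).trans (.trans ?_ (K.autConj_tr _ _).symm))
    exact ⟨_, unit_aux_right K.obj_one f.hom⟩

theorem tr_lam_hom {a b c ab bc abc : Skeleton G} (hab : a * b = ab) (hbc : b * c = bc)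
    (h : a * b * c = abc) :
    (tr (fun a => Aut (K.obj a)) h (K.lam a b c)).hom =
      (K.Γ' (show ab * c = abc by rw [← hab, h])).inv ≫ (K.Γ' hab).inv ▷ K.obj c ≫
        (α_ _ _ _).hom ≫ K.obj a ◁ (K.Γ' hbc).hom ≫
          (K.Γ' (show a * bc = abc by rw [← hbc, ← h, mul_assoc])).hom := by
  subst hab hbc h
  rw [tr_self]
  simp [lam, Γ']

theorem tr_push_hom {a b c : Skeleton G} (h : a * b = c) (f : Aut (K.obj b)) :
    (tr (fun a => Aut (K.obj a)) h (K.push a b f)).hom =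
      (K.Γ' h).inv ≫ K.obj a ◁ f.hom ≫ (K.Γ' h).hom := by
  subst h
  rw [tr_self]
  simp [push, Γ', Iso.conj_apply]
  rfl

theorem tr_pull_hom {a b c : Skeleton G} (h : a * b = c) (f : Aut (K.obj a)) :
    (tr (fun a => Aut (K.obj a)) h (K.pull a b f)).hom =
      (K.Γ' h).inv ≫ f.hom ▷ K.obj b ≫ (K.Γ' h).hom := by
  subst h
  rw [tr_self]
  simp [pull, Γ', Iso.conj_apply]
  rfl

theorem eq_one_of_tr {a b : Skeleton G} (h : a = b) {f : Aut (K.obj a)}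
    (hf : (tr (fun a => Aut (K.obj a)) h f).hom = 𝟙 _) : f = 1 := by
  subst h
  exact Iso.ext hf

theorem lam_one {a b c : Skeleton G} (h : a = 1 ∨ b = 1 ∨ c = 1) : K.lam a b c = 1 := by
  rcases h with rfl | rfl | rfl
  · apply K.eq_one_of_tr (show 1 * b * c = b * c by rw [one_mul])
    rw [K.tr_lam_hom (one_mul b) rfl, K.Γ'_one_left, K.Γ'_one_left]
    exact lam_aux_left _ _
  · apply K.eq_one_of_tr (show a * 1 * c = a * c by rw [mul_one])
    rw [K.tr_lam_hom (mul_one a) (one_mul c), K.Γ'_one_left, K.Γ'_one_right]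
    exact lam_aux_mid _ _
  · apply K.eq_one_of_tr (show a * b * 1 = a * b by rw [mul_one])
    rw [K.tr_lam_hom rfl (mul_one b), K.Γ'_one_right, K.Γ'_one_right]
    exact lam_aux_right _ _

theorem lam_cocycle (a b c d : Skeleton G) :
    (tr (fun a => Aut (K.obj a)) rfl (K.pull (a * b * c) d (K.lam a b c))).hom ≫
      (tr (fun a => Aut (K.obj a)) (show a * (b * c) * d = a * b * c * d by simp only [mul_assoc])
        (K.lam a (b * c) d)).hom ≫
      (tr (fun a => Aut (K.obj a)) (show a * (b * c * d) = a * b * c * d by simp only [mul_assoc])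
        (K.push a (b * c * d) (K.lam b c d))).hom =
    (tr (fun a => Aut (K.obj a)) rfl (K.lam (a * b) c d)).hom ≫
      (tr (fun a => Aut (K.obj a)) (show a * b * (c * d) = a * b * c * d by simp only [mul_assoc])
        (K.lam a b (c * d))).hom := by
  have hl := K.tr_lam_hom (rfl : a * b = _) (rfl : b * c = _) (rfl : a * b * c = _)
  have hl' := K.tr_lam_hom (rfl : b * c = _) (rfl : c * d = _) (rfl : b * c * d = _)
  rw [tr_self] at hl hl'
  rw [K.tr_push_hom, K.tr_pull_hom, hl, hl',
    K.tr_lam_hom (show a * (b * c) = a * b * c by rw [mul_assoc]) (rfl : b * c * d = _),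
    K.tr_lam_hom (rfl : a * b = _) (show b * (c * d) = b * c * d by rw [mul_assoc]),
    K.tr_lam_hom (rfl : a * b * c = _) (rfl : c * d = _)]
  exact pentagon_aux _ _ _ _ _ _ _ _ _ _

theorem coboundary_aux {A : Type v} [CommGroup A] {p q r s t : A}
    (h : p * r * t = s * q) : p * q⁻¹ * r * s⁻¹ * t = 1 := by
  have h2 : p * q⁻¹ * r * s⁻¹ * t = (p * r * t) * (s * q)⁻¹ := by
    rw [mul_inv]; ac_rfl
  rw [h2, h, mul_inv_cancel]

theorem lam_mem : (K.lam : ∀ a b c, K.module.A (a * b * c)) ∈ K.module.Z₃ := by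
  refine ⟨fun a b c h => K.lam_one h, ?_⟩
  change K.module.d₃ K.lam = 1
  funext a b c d
  exact coboundary_aux (Iso.ext (K.lam_cocycle a b c d))

/-- The cocycle `λ(G)`. -/
noncomputable def cocycle : K.module.Z₃ := ⟨K.lam, K.lam_mem⟩

end Cleavage

section invariant

variable {G : Type u} [Category.{v} G] [MonoidalCategory G]
  {M : Type u} [Monoid M] {D : DModule.{u, v} M} (T : TypeData G D) (K : Cleavage G)

theorem TypeData.autConj_j {a : M} {X Y : G} (hX : toSkeleton X = T.i a) (hY : toSkeleton Y = T.i a)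
    (g : D.A a) : AutConj (T.j hX g) (T.j hY g) := by
  obtain ⟨e⟩ := toSkeleton_eq_toSkeleton_iff.mp (hX.trans hY.symm)
  exact ⟨e, by rw [T.j_conj hX hY e g, Iso.hom_inv_id_assoc]⟩

variable [IsAbelianGroupoid G]

/-- The isomorphism `𝕛⁻¹ : i^*(𝔸(G), Θ(G)) ⟶ D`. -/
noncomputable def TypeData.jInv : DModule.Hom (K.module.comap (T.i : M →* Skeleton G)) D where
  app a := (T.j (K.toSkeleton_obj (T.i a))).symm.toMonoidHom
  app_push a b f := by
    refine (T.j (K.toSkeleton_obj (T.i (a * b)))).symm_apply_eq.mpr (AutConj.eq ?_)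
    refine (K.autConj_tr _ _).trans ((K.autConj_push _ _ _).trans ?_)
    refine AutConj.trans ?_ (T.autConj_j (toSkeleton_tensor (K.toSkeleton_obj (T.i a))
      (K.toSkeleton_obj (T.i b))) (K.toSkeleton_obj (T.i (a * b))) _)
    refine ⟨Iso.refl _, ?_⟩
    rw [T.j_push (K.toSkeleton_obj (T.i a)) (K.toSkeleton_obj (T.i b))]
    have h : T.j (K.toSkeleton_obj (T.i b)) ((T.j (K.toSkeleton_obj (T.i b))).symm f) = f :=
      (T.j (K.toSkeleton_obj (T.i b))).apply_symm_apply f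
    refine (Category.comp_id _).trans (Eq.trans ?_ (Category.id_comp _).symm)
    refine Eq.trans ?_ (congrArg (fun x : Aut _ => K.obj (T.i a) ◁ x.hom) h.symm)
    rfl
  app_pull a b f := by
    refine (T.j (K.toSkeleton_obj (T.i (a * b)))).symm_apply_eq.mpr (AutConj.eq ?_)
    refine (K.autConj_tr _ _).trans ((K.autConj_pull _ _ _).trans ?_)
    refine AutConj.trans ?_ (T.autConj_j (toSkeleton_tensor (K.toSkeleton_obj (T.i a))
      (K.toSkeleton_obj (T.i b))) (K.toSkeleton_obj (T.i (a * b))) _)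
    refine ⟨Iso.refl _, ?_⟩
    rw [T.j_pull (K.toSkeleton_obj (T.i a)) (K.toSkeleton_obj (T.i b))]
    have h : T.j (K.toSkeleton_obj (T.i a)) ((T.j (K.toSkeleton_obj (T.i a))).symm f) = f :=
      (T.j (K.toSkeleton_obj (T.i a))).apply_symm_apply f
    refine (Category.comp_id _).trans (Eq.trans ?_ (Category.id_comp _).symm)
    refine Eq.trans ?_ (congrArg (fun x : Aut _ => x.hom ▷ K.obj (T.i b)) h.symm)
    rfl

/-- The class `c(G) = 𝕛_*⁻¹ (i^* [λ(G)])` in `H³(M, D)`. -/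
noncomputable def TypeData.c : D.H₃ :=
  DModule.H₃.map (T.jInv K)
    (DModule.H₃.comap K.module (T.i : M →* Skeleton G) (QuotientGroup.mk K.cocycle))

end invariant

end Leech

open Leech

/-! Everything is reduced to the groupoids `Sig D l`, where categorical data become cochains.

Let `G` be a monoidal abelian groupoid of type `(M, D)` with a cleavage. The chosen objects `X_a`
and isomorphisms `Γ` form a monoidal functor `TypeData.realize` from the groupoid of the cocycle of
`G` to `G`: the equation defining `λ(G)` is its associativity hexagon, and the normalization of `Γ`
gives the unit axioms. This functor is of type `(1, 1)`, so it is bijective on isomorphism classes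
and on automorphism groups, and between groupoids this makes it an equivalence
(`IsOfType.isEquivalence`, `TypeData.sig_isEquivalent`).

Now consider a monoidal functor of type `(p, q)` from `Sig D l` to `Sig D' l'`. Up to isomorphism
its underlying functor is determined by `(p, q)` and its unit constraint is `1`
(`Sig.exists_iso_functor`), so only the tensorator remains, a 2-cochain `φ` with values in `p^* D'`.
Naturality is free because the groups are abelian, the unit axioms say that `φ` is normalized, and
the hexagon says `q_* l = p^* l' · ∂²φ` (`Sig.hexagon_iff`). A monoidal isomorphism from the functor
of `φ` to that of `ψ` is a normalized 1-cochain `δ` with `φ = ψ · ∂¹δ` (`Sig.isMonoidal_iff`). Hence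
such functors exist exactly when the classes in `H³` agree; the solutions `φ` then form a coset of
the 2-cocycles, and their isomorphism classes form a torsor under `H²`. Conjugation by equivalences
carries this over to arbitrary `G` and `G'`.

The bijection with `H³` is the case `p = 1`, `q = 1`. Independence of the cleavage and the value of
`c` on `Sig D l` then follow formally. The existence of types rests on conjugation: it identifies
automorphism groups of isomorphic objects independently of the isomorphism used. -/

namespace Leech

/-! ### Every monoidal abelian groupoid has a type. -/

section existence

variable {G : Type u} [Category.{v} G]

/-- All isomorphisms between two objects of an abelian groupoid induce the same map on
automorphisms. -/
theorem conjAut_eq [IsAbelianGroupoid G] {X Y : G} (e e' : X ≅ Y) (f : Aut X) :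
    e.conjAut f = e'.conjAut f :=
  AutConj.eq ((autConj_conjAut e f).trans (autConj_conjAut e' f).symm)

/-- By commutativity `e'` may be replaced by `e ≪≫ h`. This makes isomorphisms chosen independently
for different objects compatible with all arrows. -/
theorem conjAut_trans_hom [IsAbelianGroupoid G] {X Y Z : G} (e : X ≅ Y) (e' : X ≅ Z) (h : Y ≅ Z)
    (f : Aut X) : (e'.conjAut f).hom = h.inv ≫ (e.conjAut f).hom ≫ h.hom := by
  rw [conjAut_eq e' (e ≪≫ h) f]
  simp [Iso.conjAut_hom, Iso.conj_apply]

variable [MonoidalCategory G]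

/-- The conjugating isomorphism is `e ⊗ e'`; by the interchange law only `e'` affects `f`. -/
theorem autConj_whiskerLeft {X Y X' Y' : G} (e : X ≅ X') (e' : Y ≅ Y') (f : Aut Y) :
    AutConj ((tensorLeft X).mapAut Y f) ((tensorLeft X').mapAut Y' (e'.conjAut f)) := by
  refine ⟨e ⊗ᵢ e', ?_⟩
  change X ◁ f.hom ≫ (e.hom ⊗ₘ e'.hom) = (e.hom ⊗ₘ e'.hom) ≫ X' ◁ (e'.conjAut f).hom
  rw [Iso.conjAut_hom, Iso.conj_apply]
  simp [MonoidalCategory.tensorHom_def, whisker_exchange_assoc, ← whiskerLeft_comp]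

theorem autConj_whiskerRight {X Y X' Y' : G} (e : X ≅ X') (e' : Y ≅ Y') (f : Aut X) :
    AutConj ((tensorRight Y).mapAut X f) ((tensorRight Y').mapAut X' (e.conjAut f)) := by
  refine ⟨e ⊗ᵢ e', ?_⟩
  change f.hom ▷ Y ≫ (e.hom ⊗ₘ e'.hom) = (e.hom ⊗ₘ e'.hom) ≫ (e.conjAut f).hom ▷ Y'
  rw [Iso.conjAut_hom, Iso.conj_apply]
  simp [MonoidalCategory.tensorHom_def', ← whisker_exchange_assoc, ← comp_whiskerRight]

variable (K : Cleavage G)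

theorem Cleavage.nonempty_iso {a : Skeleton G} {X : G} (h : toSkeleton X = a) :
    Nonempty (K.obj a ≅ X) :=
  toSkeleton_eq_toSkeleton_iff.mp ((K.toSkeleton_obj a).trans h.symm)

/-- A monoidal abelian groupoid is of the type of its monoid of isomorphism classes and of the
module of automorphisms of the objects chosen by a cleavage. -/
noncomputable def Cleavage.typeData [IsAbelianGroupoid G] : TypeData G K.module where
  i := MulEquiv.refl _
  -- An arbitrary isomorphism suffices, since conjugation does not depend on it. In the last two
  -- fields both sides are automorphisms of `X ⊗ Y` conjugate to the same automorphism of `X_a ⊗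
  -- X_b`, hence equal.
  j hX := (K.nonempty_iso hX).some.conjAut
  j_conj _ _ h g := conjAut_trans_hom _ _ h g
  j_push hX hY f :=
    congrArg Iso.hom (AutConj.eq ((autConj_conjAut _ _).trans ((K.autConj_push _ _ f).trans
      (autConj_whiskerLeft (K.nonempty_iso hX).some (K.nonempty_iso hY).some f))))
  j_pull hX hY f :=
    congrArg Iso.hom (AutConj.eq ((autConj_conjAut _ _).trans ((K.autConj_pull _ _ f).trans
      (autConj_whiskerRight (K.nonempty_iso hX).some (K.nonempty_iso hY).some f))))

end existence

/-! ### Every monoidal functor has a type. -/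

section functors

variable {G : Type u} [Category.{v} G] [MonoidalCategory G]
  {G' : Type u'} [Category.{v'} G'] [MonoidalCategory G']
  {M : Type u} [Monoid M] {D : DModule.{u, v} M}
  {M' : Type u'} [Monoid M'] {D' : DModule.{u', v'} M'}
  {T : TypeData G D} {T' : TypeData G' D'}

theorem TypeData.exists_rep (T : TypeData G D) (a : M) : ∃ X : G, toSkeleton X = T.i a :=
  Quotient.exists_rep (T.i a)

theorem TypeData.j_comp (T : TypeData G D) {a : M} {X Y : G} (hX : toSkeleton X = T.i a)
    (hY : toSkeleton Y = T.i a) (h : X ≅ Y) (g : D.A a) :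
    h.hom ≫ (T.j hY g).hom = (T.j hX g).hom ≫ h.hom := by
  rw [T.j_conj hX hY h, Iso.hom_inv_id_assoc]

theorem TypeData.j_tr (T : TypeData G D) {a b : M} {X : G} (h : a = b) (hX : toSkeleton X = T.i a)
    (hX' : toSkeleton X = T.i b) (g : D.A a) : T.j hX' (tr D.A h g) = T.j hX g := by
  subst h; rfl

/-- The value of `F(j_X g)`, up to conjugation, depends only on `a`, for `X ∈ i(a)`. -/
theorem TypeData.j_symm_map (T : TypeData G D) (T' : TypeData G' D') (F : G ⥤ G') {a : M} {b : M'}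
    {X Y : G}
    (hX : toSkeleton X = T.i a) (hY : toSkeleton Y = T.i a)
    (hFX : toSkeleton (F.obj X) = T'.i b) (hFY : toSkeleton (F.obj Y) = T'.i b) (g : D.A a) :
    (T'.j hFX).symm (F.mapAut X (T.j hX g)) = (T'.j hFY).symm (F.mapAut Y (T.j hY g)) := by
  obtain ⟨h⟩ := toSkeleton_eq_toSkeleton_iff.mp (hX.trans hY.symm)
  rw [MulEquiv.eq_symm_apply]
  ext
  rw [T'.j_conj hFX hFY (F.mapIso h), MulEquiv.apply_symm_apply]
  change F.map _ ≫ F.map (T.j hX g).hom ≫ F.map _ = F.map (T.j hY g).hom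
  rw [T.j_conj hX hY h, F.map_comp, F.map_comp]

/-- The map `p` is the action of `F` on isomorphism classes, and `q` its action on automorphisms of
representatives, read through `j` and `j'`. By `TypeData.j_symm_map` the representatives do not
matter, so compatibility with products can be tested on `X_a ⊗ X_b`, where the structure maps of `F`
apply. -/
theorem exists_isOfType (T : TypeData G D) (T' : TypeData G' D') (F : G ⥤ G') [F.Monoidal] :
    ∃ (p : M →* M') (q : DModule.Hom D (D'.comap p)), IsOfType T T' p q.app F := by
  choose X hX using T.exists_rep
  have key : ∀ {a : M} {Y : G}, toSkeleton Y = T.i a →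
      T'.i (T'.i.symm (toSkeleton (F.obj (X a)))) = toSkeleton (F.obj Y) := fun {a Y} hY => by
    rw [MulEquiv.apply_symm_apply]
    obtain ⟨h⟩ := toSkeleton_eq_toSkeleton_iff.mp ((hX a).trans hY.symm)
    exact congr_toSkeleton_of_iso (F.mapIso h)
  let p : M →* M' :=
    { toFun a := T'.i.symm (toSkeleton (F.obj (X a)))
      map_one' := by
        apply T'.i.injective
        rw [key (Y := 𝟙_ G) (map_one T.i).symm, map_one]
        exact (congr_toSkeleton_of_iso (Functor.Monoidal.εIso F)).symm
      map_mul' a b := by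
        apply T'.i.injective
        rw [key (toSkeleton_tensor (hX a) (hX b)), map_mul, MulEquiv.apply_symm_apply,
          MulEquiv.apply_symm_apply, ← Skeleton.toSkeleton_tensorObj]
        exact (congr_toSkeleton_of_iso (Functor.Monoidal.μIso F _ _)).symm }
  have hp : ∀ {a : M} {Y : G}, toSkeleton Y = T.i a → toSkeleton (F.obj Y) = T'.i (p a) :=
    fun hY => (key hY).symm
  let q : ∀ a, D.A a →* D'.A (p a) := fun a =>
    (T'.j (hp (hX a))).symm.toMonoidHom.comp
      ((F.mapAut (X a)).comp (T.j (hX a)).toMonoidHom)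
  have hq : ∀ {a : M} {Y : G} (hY : toSkeleton Y = T.i a) (g : D.A a),
      (T'.j (hp hY) (q a g)).hom = F.map (T.j hY g).hom := fun {a Y} hY g => by
    have h : q a g = (T'.j (hp hY)).symm (F.mapAut Y (T.j hY g)) :=
      T.j_symm_map T' F (hX a) hY (hp (hX a)) (hp hY) g
    rw [h, MulEquiv.apply_symm_apply]; rfl
  refine ⟨p, ⟨q, fun a b f => ?_, fun a b g => ?_⟩, fun a Y hY => ⟨hp hY, hq hY⟩⟩
  · have hab := toSkeleton_tensor (hX a) (hX b)
    refine (T'.j (hp hab)).injective (Iso.ext ?_)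
    refine (hq hab _).trans ?_
    rw [T.j_push (hX a) (hX b)]
    -- Conjugation by `μ` carries `j'` from `F X_a ⊗ F X_b`, where `j_push` computes it, to `F (X_a
    -- ⊗ X_b)`.
    have h := (T'.j_conj (toSkeleton_tensor (hp (hX a)) (hp (hX b)))
      ((hp hab).trans (congrArg T'.i (map_mul p a b)))
      (Functor.Monoidal.μIso F _ _) (D'.push (p a) (p b) (q b f))).symm
    refine Eq.trans ?_ (h.trans (congrArg Iso.hom (T'.j_tr (map_mul p a b).symm _ _ _).symm))
    rw [T'.j_push (hp (hX a)) (hp (hX b)), hq (hX b)]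
    exact Functor.Monoidal.map_whiskerLeft F _ _
  · have hab := toSkeleton_tensor (hX a) (hX b)
    refine (T'.j (hp hab)).injective (Iso.ext ?_)
    refine (hq hab _).trans ?_
    rw [T.j_pull (hX a) (hX b)]
    have h := (T'.j_conj (toSkeleton_tensor (hp (hX a)) (hp (hX b)))
      ((hp hab).trans (congrArg T'.i (map_mul p a b)))
      (Functor.Monoidal.μIso F _ _) (D'.pull (p a) (p b) (q a g))).symm
    refine Eq.trans ?_ (h.trans (congrArg Iso.hom (T'.j_tr (map_mul p a b).symm _ _ _).symm))
    rw [T'.j_pull (hp (hX a)) (hp (hX b)), hq (hX a)]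
    exact Functor.Monoidal.map_whiskerRight F _ _

theorem IsOfType.comp {G'' : Type*} [Category* G''] [MonoidalCategory G''] {M'' : Type _} [Monoid M'']
    {D'' : DModule M''} {T'' : TypeData G'' D''} {p : M →* M'} {q : ∀ a, D.A a →* D'.A (p a)}
    {p' : M' →* M''} {q' : ∀ a, D'.A a →* D''.A (p' a)} {F : G ⥤ G'} {F' : G' ⥤ G''}
    (h : IsOfType T T' p q F) (h' : IsOfType T' T'' p' q' F') :
    IsOfType T T'' (p'.comp p) (fun a => (q' (p a)).comp (q a)) (F ⋙ F') := fun a X hX => by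
  obtain ⟨hFX, hj⟩ := h a X hX
  obtain ⟨hFX', hj'⟩ := h' _ _ hFX
  exact ⟨hFX', fun g => (hj' (q a g)).trans (congrArg F'.map (hj g))⟩

end functors

/-! ### Functors of type `(1, 1)` are equivalences. -/

section equivalences

variable {G G' : Type u} [Category.{v} G] [MonoidalCategory G]
  [Category.{v} G'] [MonoidalCategory G'] [IsGroupoid G] [IsGroupoid G']
  {M : Type u} [Monoid M] {D : DModule.{u, v} M} {T : TypeData G D} {T' : TypeData G' D}

/-- A functor of type `(1, 1)` is an equivalence. -/
theorem IsOfType.isEquivalence {F : G ⥤ G'}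
    (h : IsOfType T T' (MonoidHom.id M) (fun a => MonoidHom.id (D.A a)) F) :
    F.IsEquivalence := by
  have hi : ∀ X : G, ∃ a, toSkeleton X = T.i a := fun X => by
    obtain ⟨a, ha⟩ := T.i.surjective (toSkeleton X)
    exact ⟨a, ha.symm⟩
  -- On automorphism groups `F` is `j' ∘ j⁻¹`; on isomorphism classes it is `i' ∘ i⁻¹`.
  have haut : ∀ X : G, Function.Bijective (F.mapAut X) := fun X => by
    obtain ⟨a, ha⟩ := hi X
    obtain ⟨hFX, hj⟩ := h a X ha
    have : ⇑(F.mapAut X) = T'.j hFX ∘ (T.j ha).symm := funext fun f => Iso.ext (by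
      refine Eq.trans ?_ (hj ((T.j ha).symm f)).symm
      rw [MulEquiv.apply_symm_apply]; rfl)
    rw [this]
    exact (T'.j hFX).bijective.comp (T.j ha).symm.bijective
  have hiso : ∀ {X Y : G}, Nonempty (F.obj X ≅ F.obj Y) → Nonempty (X ≅ Y) := fun {X Y} e => by
    obtain ⟨a, ha⟩ := hi X
    obtain ⟨b, hb⟩ := hi Y
    have hab : T'.i a = T'.i b :=
      (h a X ha).1.symm.trans ((toSkeleton_eq_toSkeleton_iff.mpr e).trans (h b Y hb).1)
    exact toSkeleton_eq_toSkeleton_iff.mp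
      (ha.trans ((congrArg T.i (T'.i.injective hab)).trans hb.symm))
  -- Parallel arrows of a groupoid differ by an automorphism of the source, so injectivity on
  -- automorphism groups is enough.
  have : F.Faithful := ⟨fun {X Y} f g hfg => by
    have := (haut X).1 (a₁ := asIso f ≪≫ (asIso g).symm) (a₂ := 1) (Iso.ext (by
      change F.map (f ≫ inv g) = F.map (𝟙 X)
      simp [hfg]))
    have h2 : f ≫ inv g = 𝟙 X := congrArg Iso.hom this
    exact (cancel_mono (inv g)).mp (by simpa using h2)⟩
  -- An arrow `F X ⟶ F Y` yields some `e : X ≅ Y`; the discrepancy between `f` and `F e` is an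
  -- automorphism of `F X`, which lifts.
  have : F.Full := ⟨fun {X Y} f => by
    obtain ⟨e⟩ := hiso ⟨asIso f⟩
    obtain ⟨g, hg⟩ := (haut X).2 (asIso f ≪≫ (F.mapIso e).symm)
    refine ⟨g.hom ≫ e.hom, ?_⟩
    have h2 : F.map g.hom = f ≫ F.map e.inv := congrArg Iso.hom hg
    rw [F.map_comp, h2, Category.assoc, ← F.map_comp, e.inv_hom_id, F.map_id, Category.comp_id]⟩
  have : F.EssSurj := ⟨fun Y => by
    obtain ⟨a, ha⟩ := T'.i.surjective (toSkeleton Y)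
    obtain ⟨X, hX⟩ := T.exists_rep a
    exact ⟨X, toSkeleton_eq_toSkeleton_iff.mp ((h a X hX).1.trans ha)⟩⟩
  exact {}

end equivalences

/-- The inverse receives the monoidal structure of a right adjoint of a monoidal functor, for which
the adjunction is automatically monoidal. -/
theorem MonAbGpdOfType.isEquivalent_of_equivalence {M : Type u} [Monoid M] {D : DModule.{u, v} M}
    {S T : MonAbGpdOfType D} (e : S.carrier ≌ T.carrier) [e.functor.Monoidal]
    (h : IsOfType S.type T.type (MonoidHom.id M) (fun a => MonoidHom.id (D.A a)) e.functor) :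
    S.IsEquivalent T :=
  ⟨e, inferInstance, e.inverseMonoidal,
    (letI := e.toAdjunction.rightAdjointLaxMonoidal
    inferInstance : @Adjunction.IsMonoidal _ _ _ _ _ _ _ _ e.toAdjunction _
      e.toAdjunction.rightAdjointLaxMonoidal), h⟩

theorem MonAbGpdOfType.isEquivalent_of_isOfType {M : Type u} [Monoid M] {D : DModule.{u, v} M}
    {S T : MonAbGpdOfType D} (F : S.carrier ⥤ T.carrier) [hF : F.Monoidal]
    (h : IsOfType S.type T.type (MonoidHom.id M) (fun a => MonoidHom.id (D.A a)) F) :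
    S.IsEquivalent T :=
  have := h.isEquivalence
  @isEquivalent_of_equivalence _ _ _ S T F.asEquivalence hF h

/-! ### Identities in abelian groups behind the monoidal axioms. -/

theorem tr_inj {M : Type u} {A : M → Type v} [∀ a, CommGroup (A a)] {a b : M} (h : a = b)
    {x y : A a} : tr A h x = tr A h y ↔ x = y := by
  subst h; rfl

theorem tr_eq_one {M : Type u} {A : M → Type v} [∀ a, CommGroup (A a)] {a b : M} (h : a = b)
    {x : A a} : tr A h x = 1 ↔ x = 1 := by
  subst h; rfl

/-- Clearing inverses turns an equation with `∂²φ` into the two composites of a hexagon. -/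
theorem eq_mul_coboundary_iff {A : Type*} [CommGroup A] {x y a b c d : A} :
    y = x * (a * b⁻¹ * c * d⁻¹) ↔ y * b * d = c * a * x := by
  have h : x * (a * b⁻¹ * c * d⁻¹) = (c * a * x) * (b * d)⁻¹ := by
    rw [mul_inv]; ac_rfl
  rw [h, eq_mul_inv_iff_mul_eq, mul_assoc y]

/-- Naturality of a tensorator in `Sig` is just commutativity, so it imposes no condition. -/
theorem naturality_aux {M : Type u} {A : M → Type v} [∀ a, CommGroup (A a)] {x y : M} (h : x = y) (f : A y)
    (m : A y) : m * f = tr A h (tr A h.symm f) * m := by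
  rw [tr_tr, tr_self, mul_comm]

/-- Here `f` is the image of a unitor, `m` the tensorator and `e` the whiskered unit constraint:
when the outer two are trivial, unitality is the normalization of `m`. -/
theorem unitality_aux {M : Type u} {A : M → Type v} [∀ a, CommGroup (A a)] {x y z : M} (h : x = y) (k : y = z)
    {f : A x} {m : A y} {e : A z} (hf : f = 1) (he : e = 1) :
    1 = tr A k (tr A h f * m) * e ↔ m = 1 := by
  subst h k hf he
  simp [eq_comm]

/-! ### Monoidal functors between cocycle groupoids as 2-cochains. -/

namespace Sig

section

variable {M : Type u} [Monoid M] {D : DModule.{u, v} M} {l : D.Z₃}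
  {M' : Type u'} [Monoid M'] {D' : DModule.{u', v'} M'} {l' : D'.Z₃}
  (p : M →* M') (q : DModule.Hom D (D'.comap p))

variable (l l') in
/-- The functor `Σ(M, D, l) ⥤ Σ(M', D', l')` given by `p` on objects and by `q` on arrows. -/
def functor : Sig D l ⥤ Sig D' l' where
  obj X := ⟨p X.pt⟩
  map {X _} f := ⟨congrArg p f.eq, q.app X.pt f.val⟩
  map_id X := hom_ext (map_one (q.app X.pt))
  map_comp {X Y Z} f g := hom_ext (by
    obtain ⟨a⟩ := X; obtain ⟨b⟩ := Y; obtain ⟨c⟩ := Z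
    obtain ⟨h, f⟩ := f; obtain ⟨h', g⟩ := g
    cases h; cases h'
    exact map_mul (q.app a) g f)

theorem functor_isOfType :
    IsOfType (typeData D l) (typeData D' l') p q.app (functor l l' p q) := fun a X hX => by
  obtain ⟨x⟩ := X
  obtain rfl : x = a := pt_eq hX
  exact ⟨rfl, fun g => rfl⟩

/-- The tensorator appears as a cochain `φ`, indexed by `p (a * b)`, and as an arrow `m`, indexed by
its source `p a * p b`. Transport to `p a * p b * p c` is injective, so the two forms of the
equation can be compared there. -/
theorem hexagon_aux (φ : ∀ a b, D'.A (p (a * b))) (m : ∀ a b, D'.A (p a * p b))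
    (hm : ∀ a b, m a b = tr D'.A (map_mul p a b) (φ a b)) (a b c : M) (L : D'.A (p (a * b * c))) :
    L = tr D'.A (by simp only [map_mul]) (l'.1 (p a) (p b) (p c)) *
      (tr (fun a => D'.A (p a)) (mul_assoc a b c).symm (tr D'.A (map_mul p a (b * c)).symm
          (D'.push (p a) (p (b * c)) (φ b c))) * (φ (a * b) c)⁻¹ *
        tr (fun a => D'.A (p a)) (mul_assoc a b c).symm (φ a (b * c)) *
        (tr D'.A (map_mul p (a * b) c).symm (D'.pull (p (a * b)) (p c) (φ a b)))⁻¹) ↔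
    tr D'.A (congrArg (· * p c) (map_mul p a b))
        (tr D'.A (map_mul p (a * b) c) L * m (a * b) c) * D'.pull (p a * p b) (p c) (m a b) =
      tr D'.A (mul_assoc (p a) (p b) (p c)).symm
        (tr D'.A (congrArg (p a * ·) (map_mul p b c)) (m a (b * c)) *
          D'.push (p a) (p b * p c) (m b c)) * l'.1 (p a) (p b) (p c) := by
  rw [← tr_inj (A := D'.A) (show p (a * b * c) = p a * p b * p c by simp only [map_mul])]
  simp only [hm, map_mul, map_inv, tr_tr, tr_self, DModule.push_tr, DModule.pull_tr,
    DModule.comap_tr]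
  exact eq_mul_coboundary_iff

/-- The hexagon for a monoidal structure on `functor l l' p q` with tensorator `m`. -/
theorem hexagon_iff (φ : ∀ a b, D'.A (p (a * b))) (m : ∀ a b, D'.A (p a * p b))
    (hm : ∀ a b, m a b = tr D'.A (map_mul p a b) (φ a b)) :
    q.on₃ l.1 = D'.comap₃ p l'.1 * (D'.comap p).d₂ φ ↔
      ∀ a b c, tr D'.A (congrArg (· * p c) (map_mul p a b))
        (tr D'.A (map_mul p (a * b) c) (q.app _ (l.1 a b c)) * m (a * b) c) *
          D'.pull (p a * p b) (p c) (m a b) =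
      tr D'.A (mul_assoc (p a) (p b) (p c)).symm
        (tr D'.A (congrArg (p a * ·) (map_mul p b c)) (m a (b * c)) *
          D'.push (p a) (p b * p c) (m b c)) * l'.1 (p a) (p b) (p c) := by
  have h := fun a b c => hexagon_aux (l' := l') p φ m hm a b c (q.app _ (l.1 a b c))
  exact ⟨fun h' a b c => (h a b c).1 (congrFun (congrFun (congrFun h' a) b) c),
    fun h' => funext fun a => funext fun b => funext fun c => (h a b c).2 (h' a b c)⟩

variable (l l') in
/-- The normalized 2-cochains which are the tensorators of monoidal functors of type `(p, q)`. -/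
def tensorators : Set (∀ a b, (D'.comap p).A (a * b)) :=
  {φ | φ ∈ (D'.comap p).C₂ ∧ q.on₃ l.1 = D'.comap₃ p l'.1 * (D'.comap p).d₂ φ}

variable {p q}

/-- The monoidal structure on `functor l l' p q` with tensorator `φ`. -/
def coreMonoidal {φ : ∀ a b, (D'.comap p).A (a * b)} (hφ : φ ∈ tensorators l l' p q) :
    (functor l l' p q).CoreMonoidal where
  -- A trivial unit constraint loses nothing up to isomorphism, by `exists_iso_functor`.
  εIso := isoMk (map_one p).symm 1
  μIso X Y := isoMk (map_mul p X.pt Y.pt).symm (tr D'.A (map_mul p X.pt Y.pt) (φ X.pt Y.pt))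
  μIso_hom_natural_left {X Y} f Z := hom_ext (by
    obtain ⟨a⟩ := X; obtain ⟨b⟩ := Y; obtain ⟨c⟩ := Z; obtain ⟨e, f⟩ := f; cases e
    exact (naturality_aux (map_mul p a c) _ _).trans
      (congrArg (fun x => tr D'.A (map_mul p a c) x * _) (q.app_pull a c f).symm))
  μIso_hom_natural_right {X Y} Z f := hom_ext (by
    obtain ⟨a⟩ := X; obtain ⟨b⟩ := Y; obtain ⟨c⟩ := Z; obtain ⟨e, f⟩ := f; cases e
    exact (naturality_aux (map_mul p c a) _ _).trans
      (congrArg (fun x => tr D'.A (map_mul p c a) x * _) (q.app_push c a f).symm))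
  associativity X Y Z := hom_ext
    ((hexagon_iff p q φ _ fun _ _ => rfl).1 hφ.2 X.pt Y.pt Z.pt)
  left_unitality X := hom_ext
    ((unitality_aux (map_mul p 1 X.pt) (congrArg (· * p X.pt) (map_one p))
      (map_one (q.app (1 * X.pt))) (map_one (D'.pull 1 (p X.pt)))).2
      ((tr_eq_one (A := D'.A) (map_mul p 1 X.pt)).2 (hφ.1 _ _ (Or.inl rfl))))
  right_unitality X := hom_ext
    ((unitality_aux (map_mul p X.pt 1) (congrArg (p X.pt * ·) (map_one p))
      (map_one (q.app (X.pt * 1))) (map_one (D'.push (p X.pt) 1))).2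
      ((tr_eq_one (A := D'.A) (map_mul p X.pt 1)).2 (hφ.1 _ _ (Or.inr rfl))))

/-- The monoidal functor of type `(p, q)` with tensorator `φ`. -/
def monFunctor {φ : ∀ a b, (D'.comap p).A (a * b)} (hφ : φ ∈ tensorators l l' p q) :
    MonFunctor (typeData D l) (typeData D' l') p q where
  F := functor l l' p q
  monoidal := (coreMonoidal hφ).toMonoidal
  isOfType := functor_isOfType p q

open Functor.LaxMonoidal in
/-- The tensorator of a monoidal structure on `functor l l' p q` with trivial unit. -/
theorem mem_tensorators [(functor l l' p q).Monoidal]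
    (hε : Hom.val (ε (functor l l' p q)) = 1) :
    (fun a b => tr D'.A (map_mul p a b).symm (μ (functor l l' p q) ⟨a⟩ ⟨b⟩).val :
      ∀ a b, (D'.comap p).A (a * b)) ∈ tensorators l l' p q := by
  refine ⟨fun a b h => ?_, (hexagon_iff p q _ (fun a b => (μ (functor l l' p q) ⟨a⟩ ⟨b⟩).val)
    fun a b => (tr_tr D'.A (map_mul p a b).symm (map_mul p a b) _).symm).2 fun a b c => ?_⟩
  · refine (tr_eq_one (A := D'.A) (map_mul p a b).symm).2 ?_
    rcases h with rfl | rfl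
    · have h := congrArg Hom.val (left_unitality (functor l l' p q) ⟨b⟩)
      exact (unitality_aux (map_mul p 1 b) (congrArg (· * p b) (map_one p))
        (map_one (q.app (1 * b))) (by
          exact (congrArg (D'.pull 1 (p b)) hε).trans (map_one (D'.pull 1 (p b))))).1 h
    · have h := congrArg Hom.val (right_unitality (functor l l' p q) ⟨a⟩)
      exact (unitality_aux (map_mul p a 1) (congrArg (p a * ·) (map_one p))
        (map_one (q.app (a * 1))) (by
          exact (congrArg (D'.push (p a) 1) hε).trans (map_one (D'.push (p a) 1)))).1 h
  · exact congrArg Hom.val (associativity (functor l l' p q) ⟨a⟩ ⟨b⟩ ⟨c⟩)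

end

end Sig

/-- The isomorphism along which a monoidal structure is transported is monoidal. -/
theorem isMonoidal_of_transport {C D : Type*} [Category* C] [Category* D] [MonoidalCategory C]
    [MonoidalCategory D] {F G : C ⥤ D} [F.Monoidal] (e : F ≅ G) :
    letI := Functor.Monoidal.transport e
    NatTrans.IsMonoidal e.hom :=
  letI := Functor.Monoidal.transport e
  { unit := (Functor.Monoidal.transport_ε e).symm
    tensor X Y := by
      rw [Functor.Monoidal.transport_μ]
      simp [tensorHom_comp_tensorHom_assoc] }

/-! ### Isomorphism classes of monoidal functors between cocycle groupoids. -/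

namespace Sig

variable {M : Type u} [Monoid M] {D : DModule.{u, v} M} {l : D.Z₃}
  {M' : Type u'} [Monoid M'] {D' : DModule.{u', v'} M'} {l' : D'.Z₃}
  {p : M →* M'} {q : DModule.Hom D (D'.comap p)}

/-- Any family of isomorphisms `F X ≅ p X` is natural: all arrows of `Sig D l` are automorphisms,
and the type of `F` fixes their images up to conjugation. The component at the unit is therefore
free, and `ε⁻¹` makes the transported unit constraint trivial. -/
theorem exists_iso_functor {F : Sig D l ⥤ Sig D' l'} [F.Monoidal]
    (hF : IsOfType (typeData D l) (typeData D' l') p q.app F) :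
    ∃ e : F ≅ functor l l' p q,
      Hom.val (Functor.LaxMonoidal.ε F ≫ e.hom.app (𝟙_ (Sig D l))) = 1 := by
  classical
  have h : ∀ X : Sig D l, Nonempty (F.obj X ≅ ⟨p X.pt⟩) := fun X =>
    toSkeleton_eq_toSkeleton_iff.mp (hF X.pt X rfl).1
  let e : ∀ X : Sig D l, F.obj X ≅ ⟨p X.pt⟩ :=
    Function.update (fun X => (h X).some) (𝟙_ (Sig D l))
      ((Functor.Monoidal.εIso F).symm ≪≫ isoMk (map_one p).symm 1)
  have he : e (𝟙_ (Sig D l)) = (Functor.Monoidal.εIso F).symm ≪≫ isoMk (map_one p).symm 1 :=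
    Function.update_self _ _ _
  refine ⟨NatIso.ofComponents e fun {X Y} f => ?_, ?_⟩
  · obtain ⟨a⟩ := X; obtain ⟨b⟩ := Y; obtain ⟨h, f⟩ := f; cases h
    obtain ⟨hFX, hj⟩ := hF a ⟨a⟩ rfl
    -- Since `F f` is `j'` of `q f`, the naturality square is the compatibility of `j'` with `e`.
    have h1 := (typeData D' l').j_comp hFX (Y := ⟨p a⟩) rfl (e ⟨a⟩) (q.app a f)
    exact (congrArg (· ≫ (e ⟨a⟩).hom) (hj f)).symm.trans h1.symm
  · change Hom.val (Functor.LaxMonoidal.ε F ≫ (e (𝟙_ (Sig D l))).hom) = 1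
    rw [he, Iso.trans_hom, Iso.symm_hom, Functor.Monoidal.εIso_inv,
      Functor.Monoidal.ε_η_assoc]
    rfl

/-- Every monoidal functor of type `(p, q)` is isomorphic to one of the functors `monFunctor`. -/
theorem exists_equiv_monFunctor (F : MonFunctor (typeData D l) (typeData D' l') p q) :
    ∃ (φ : _) (hφ : φ ∈ tensorators l l' p q), F ≈ monFunctor hφ := by
  obtain ⟨e, he⟩ := exists_iso_functor F.isOfType
  let mon := Functor.Monoidal.transport e
  have hε : Hom.val (Functor.LaxMonoidal.ε (functor l l' p q)) = 1 := by
    rw [Functor.Monoidal.transport_ε, he]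
  have hm : NatTrans.IsMonoidal e.hom := isMonoidal_of_transport e
  refine ⟨_, mem_tensorators hε, e, ?_⟩
  -- The target carries the structure rebuilt from the cochain rather than the transported one; the
  -- two have the same unit constraint and tensorator.
  refine @NatTrans.IsMonoidal.mk _ _ _ _ _ _ _ _ _ _ _ ?_ fun X Y => ?_
  · refine hm.unit.trans (hom_ext (hε.trans ?_))
    rfl
  · refine (hm.tensor X Y).trans ?_
    congr 1
    refine hom_ext ?_
    exact (tr_tr D'.A (map_mul p X.pt Y.pt).symm (map_mul p X.pt Y.pt) _).symm

theorem tensor_iff_aux {A : Type*} [CommGroup A] {x y d a b : A} :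
    d * x = y * (a * b) ↔ x = y * (a * d⁻¹ * b) := by
  have h : y * (a * d⁻¹ * b) = d⁻¹ * (y * (a * b)) := by ac_rfl
  rw [h, eq_inv_mul_iff_mul_eq]

theorem tensor_aux (φ ψ : ∀ a b, D'.A (p (a * b))) (δ : ∀ a, D'.A (p a)) (a b : M) :
    tr D'.A (map_mul p a b) (δ (a * b)) * tr D'.A (map_mul p a b) (φ a b) =
      tr D'.A (map_mul p a b) (ψ a b) *
        (D'.push (p a) (p b) (δ b) * D'.pull (p a) (p b) (δ a)) ↔
    φ a b = ψ a b * (tr D'.A (map_mul p a b).symm (D'.push (p a) (p b) (δ b)) * (δ (a * b))⁻¹ *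
      tr D'.A (map_mul p a b).symm (D'.pull (p a) (p b) (δ a))) := by
  rw [← tr_inj (A := D'.A) (map_mul p a b).symm]
  simp only [map_mul, tr_tr, tr_self]
  exact tensor_iff_aux

/-- Both unit constraints are `1`, so the unit axiom is `δ 1 = 1`; the tensor axiom at `(a, b)` is
the value of `φ = ψ · ∂¹δ` there, by `tensor_aux`. -/
theorem isMonoidal_iff {φ ψ : ∀ a b, (D'.comap p).A (a * b)} (hφ : φ ∈ tensorators l l' p q)
    (hψ : ψ ∈ tensorators l l' p q) (e : (monFunctor hφ).F ⟶ (monFunctor hψ).F)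
    (δ : ∀ a, (D'.comap p).A a) (hδ : ∀ a, δ a = (e.app ⟨a⟩).val) :
    NatTrans.IsMonoidal e ↔ δ 1 = 1 ∧ φ = ψ * (D'.comap p).d₁ δ := by
  have h := fun a b => tensor_aux φ ψ δ a b
  have h0 : (Functor.LaxMonoidal.ε (monFunctor hφ).F ≫ e.app (𝟙_ (Sig D l)) =
      Functor.LaxMonoidal.ε (monFunctor hψ).F) ↔ δ 1 = 1 := by
    have h2 : tr D'.A (map_one p) (δ 1) * 1 = 1 ↔ δ 1 = 1 := by
      rw [mul_one]; exact tr_eq_one (A := D'.A) (map_one p)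
    refine Iff.trans ?_ h2
    rw [hδ]
    exact ⟨fun h => congrArg Hom.val h, fun h => hom_ext h⟩
  have h1 : ∀ X Y, (Functor.LaxMonoidal.μ (monFunctor hφ).F X Y ≫ e.app (X ⊗ Y) =
      (e.app X ⊗ₘ e.app Y) ≫ Functor.LaxMonoidal.μ (monFunctor hψ).F X Y) ↔
        φ X.pt Y.pt = (ψ * (D'.comap p).d₁ δ) X.pt Y.pt := fun X Y => by
    refine Iff.trans ?_ (h X.pt Y.pt)
    simp only [hδ]
    exact ⟨fun h => congrArg Hom.val h, fun h => hom_ext h⟩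
  refine ⟨fun he => ⟨h0.1 he.unit, funext fun a => funext fun b => (h1 ⟨a⟩ ⟨b⟩).1 (he.tensor _ _)⟩,
    fun ⟨h2, h3⟩ => ⟨h0.2 h2, fun X Y => (h1 X Y).2 (by rw [← h3])⟩⟩

/-- Every 1-cochain is a natural automorphism of the common underlying functor, again by
commutativity, so only the two conditions of `isMonoidal_iff` remain. -/
theorem monFunctor_equiv_iff {φ ψ : ∀ a b, (D'.comap p).A (a * b)}
    (hφ : φ ∈ tensorators l l' p q) (hψ : ψ ∈ tensorators l l' p q) :
    monFunctor hφ ≈ monFunctor hψ ↔ ψ⁻¹ * φ ∈ (D'.comap p).B₂ := by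
  constructor
  · rintro ⟨e, he⟩
    obtain ⟨h1, h2⟩ := (isMonoidal_iff hφ hψ e.hom (fun a => (e.hom.app ⟨a⟩).val)
      fun a => rfl).1 he
    exact ⟨fun a => (e.hom.app ⟨a⟩).val, h1, eq_inv_mul_of_mul_eq h2.symm⟩
  · rintro ⟨δ, h1, h2⟩
    let e : (monFunctor hφ).F ≅ (monFunctor hψ).F :=
      NatIso.ofComponents (fun X => isoMk rfl (δ X.pt)) (fun {X Y} f => hom_ext (by
        obtain ⟨a⟩ := X; obtain ⟨b⟩ := Y; obtain ⟨h, f⟩ := f; cases h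
        exact mul_comm (G := D'.A (p a)) _ _))
    exact ⟨e, (isMonoidal_iff hφ hψ e.hom δ fun a => rfl).2
      ⟨h1, by rw [h2, mul_inv_cancel_left]⟩⟩

end Sig

/-! ### A groupoid is equivalent to the groupoid of its cocycle. -/

section realization

variable {G : Type u} [Category.{v} G] [MonoidalCategory G]

theorem Cleavage.Γ'_trans (K : Cleavage G) {a b c d : Skeleton G} (h : a * b = c) (k : c = d) :
    (K.Γ' h).hom ≫ eqToHom (congrArg K.obj k) = (K.Γ' (h.trans k)).hom := by
  subst k; simp

/-- The index `x` is kept free because it will be `T.i 1`, which equals `1` only propositionally. -/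
theorem Cleavage.Γ'_left_unit (K : Cleavage G) {a x : Skeleton G} (hx : x = 1) (h : x * a = a) :
    (K.Γ' h).hom =
      eqToHom ((congrArg K.obj hx).trans K.obj_one) ▷ K.obj a ≫ (λ_ (K.obj a)).hom := by
  subst hx
  rw [K.Γ'_one_left]; simp

theorem Cleavage.Γ'_right_unit (K : Cleavage G) {a x : Skeleton G} (hx : x = 1) (h : a * x = a) :
    (K.Γ' h).hom =
      K.obj a ◁ eqToHom ((congrArg K.obj hx).trans K.obj_one) ≫ (ρ_ (K.obj a)).hom := by
  subst hx
  rw [K.Γ'_one_right]; simp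

variable [IsAbelianGroupoid G] {M : Type u} [Monoid M] {D : DModule.{u, v} M}
  (T : TypeData G D) (K : Cleavage G)

/-- The cocycle `𝕛⁻¹_* i^* λ(G)`, which represents `c(G)`. -/
noncomputable def TypeData.cocycle : D.Z₃ :=
  ⟨(T.jInv K).on₃ (K.module.comap₃ (T.i : M →* Skeleton G) K.cocycle.1),
    (T.jInv K).on₃_mem (K.module.comap₃_mem (T.i : M →* Skeleton G) K.cocycle.2)⟩

theorem TypeData.c_eq : T.c K = QuotientGroup.mk (T.cocycle K) := rfl

theorem TypeData.j_cocycle (a b c : M) :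
    T.j (K.toSkeleton_obj (T.i (a * b * c))) ((T.cocycle K).1 a b c) =
      tr (fun a => Aut (K.obj a)) (by simp only [map_mul]) (K.lam (T.i a) (T.i b) (T.i c)) :=
  (T.j (K.toSkeleton_obj (T.i (a * b * c)))).apply_symm_apply _

/-- The functor from `Σ(M, D, l)` to `G`, for `l` the cocycle of `G`, given by the chosen
representatives of the isomorphism classes. -/
noncomputable def TypeData.realize : Sig D (T.cocycle K) ⥤ G where
  obj X := K.obj (T.i X.pt)
  map {X _} f := (T.j (K.toSkeleton_obj (T.i X.pt)) f.val).hom ≫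
    eqToHom (congrArg (fun a => K.obj (T.i a)) f.eq)
  map_id X := by
    change (T.j (K.toSkeleton_obj (T.i X.pt)) 1).hom ≫ 𝟙 _ = 𝟙 _
    rw [map_one]
    exact Category.comp_id _
  map_comp {X Y Z} f g := by
    obtain ⟨a⟩ := X; obtain ⟨b⟩ := Y; obtain ⟨c⟩ := Z
    obtain ⟨h, f⟩ := f; obtain ⟨h', g⟩ := g
    cases h; cases h'
    change (T.j (K.toSkeleton_obj (T.i a)) (g * f)).hom ≫ 𝟙 _ =
      ((T.j (K.toSkeleton_obj (T.i a)) f).hom ≫ 𝟙 _) ≫ (T.j (K.toSkeleton_obj (T.i a)) g).hom ≫ 𝟙 _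
    rw [map_mul]
    simp only [Category.comp_id]
    rfl

theorem TypeData.realize_map_mk {a : M} (f : D.A a) :
    (T.realize K).map (X := ⟨a⟩) (Y := ⟨a⟩) ⟨rfl, f⟩ = (T.j (K.toSkeleton_obj (T.i a)) f).hom :=
  Category.comp_id _

theorem TypeData.realize_map_one {X Y : Sig D (T.cocycle K)} (h : X.pt = Y.pt) :
    (T.realize K).map (X := X) (Y := Y) ⟨h, 1⟩ = eqToHom (congrArg (fun a => K.obj (T.i a)) h) := by
  change (T.j (K.toSkeleton_obj (T.i X.pt)) 1).hom ≫ eqToHom _ = _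
  rw [map_one]
  exact Category.id_comp _

theorem TypeData.realize_isOfType : IsOfType (Sig.typeData D (T.cocycle K)) T (MonoidHom.id M)
    (fun a => MonoidHom.id (D.A a)) (T.realize K) := fun a X hX => by
  obtain ⟨x⟩ := X
  obtain rfl : x = a := Sig.pt_eq hX
  exact ⟨K.toSkeleton_obj (T.i x), fun g => (T.realize_map_mk K g).symm⟩

/-- The tensorators of `realize` are the isomorphisms `Γ`. -/
noncomputable def TypeData.realizeCoreMonoidal : (T.realize K).CoreMonoidal where
  εIso := eqToIso ((congrArg K.obj (map_one T.i)).trans K.obj_one).symm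
  μIso X Y := K.Γ' (map_mul T.i X.pt Y.pt).symm
  μIso_hom_natural_left {X Y} f Z := by
    obtain ⟨a⟩ := X; obtain ⟨b⟩ := Y; obtain ⟨c⟩ := Z; obtain ⟨h, f⟩ := f; cases h
    refine Eq.trans ?_ (congrArg (_ ≫ ·) (T.realize_map_mk K (D.pull a c f)).symm)
    rw [T.realize_map_mk]
    -- Naturality of `Γ` is the invariance of `j` under the isomorphism `Γ`, once `j_pull`
    -- identifies the automorphism of the tensor product.
    refine Eq.trans ?_ (T.j_comp (toSkeleton_tensor (K.toSkeleton_obj (T.i a)) (K.toSkeleton_obj (T.i c)))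
      (K.toSkeleton_obj (T.i (a * c))) (K.Γ' (map_mul T.i a c).symm) (D.pull a c f)).symm
    rw [T.j_pull (K.toSkeleton_obj (T.i a)) (K.toSkeleton_obj (T.i c))]
    rfl
  μIso_hom_natural_right {X Y} Z f := by
    obtain ⟨a⟩ := X; obtain ⟨b⟩ := Y; obtain ⟨c⟩ := Z; obtain ⟨h, f⟩ := f; cases h
    refine Eq.trans ?_ (congrArg (_ ≫ ·) (T.realize_map_mk K (D.push c a f)).symm)
    rw [T.realize_map_mk]
    refine Eq.trans ?_ (T.j_comp (toSkeleton_tensor (K.toSkeleton_obj (T.i c)) (K.toSkeleton_obj (T.i a)))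
      (K.toSkeleton_obj (T.i (c * a))) (K.Γ' (map_mul T.i c a).symm) (D.push c a f)).symm
    rw [T.j_push (K.toSkeleton_obj (T.i c)) (K.toSkeleton_obj (T.i a))]
    rfl
  associativity X Y Z := by
    obtain ⟨a⟩ := X; obtain ⟨b⟩ := Y; obtain ⟨c⟩ := Z
    change (K.Γ' _).hom ▷ K.obj (T.i c) ≫ (K.Γ' _).hom ≫
        (T.j (K.toSkeleton_obj (T.i (a * b * c))) ((T.cocycle K).1 a b c)).hom ≫ eqToHom _ =
      (α_ (K.obj (T.i a)) (K.obj (T.i b)) (K.obj (T.i c))).hom ≫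
        K.obj (T.i a) ◁ (K.Γ' _).hom ≫ (K.Γ' _).hom
    -- The hexagon is the defining equation of `λ(G)`: after `lam` is expanded, the inverses of `Γ`
    -- cancel those on its left.
    rw [T.j_cocycle, K.tr_lam_hom (map_mul T.i a b).symm (map_mul T.i b c).symm]
    simp only [Category.assoc, Iso.hom_inv_id_assoc, hom_inv_whiskerRight_assoc]
    rw [K.Γ'_trans _ (congrArg T.i (mul_assoc a b c))]
  left_unitality X := by
    obtain ⟨a⟩ := X
    refine Eq.trans ?_ (congrArg (fun f => _ ≫ _ ≫ f)
      (T.realize_map_one K (X := 𝟙_ _ ⊗ ⟨a⟩) (Y := ⟨a⟩) (one_mul a))).symm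
    change (λ_ (K.obj (T.i a))).hom =
      eqToHom ((congrArg K.obj (map_one T.i)).trans K.obj_one).symm ▷ K.obj (T.i a) ≫
        (K.Γ' (map_mul T.i 1 a).symm).hom ≫ eqToHom (congrArg (fun a => K.obj (T.i a)) (one_mul a))
    rw [K.Γ'_trans _ (congrArg T.i (one_mul a)),
      K.Γ'_left_unit (map_one T.i)]
    simp
  right_unitality X := by
    obtain ⟨a⟩ := X
    refine Eq.trans ?_ (congrArg (fun f => _ ≫ _ ≫ f)
      (T.realize_map_one K (X := ⟨a⟩ ⊗ 𝟙_ _) (Y := ⟨a⟩) (mul_one a))).symm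
    change (ρ_ (K.obj (T.i a))).hom =
      K.obj (T.i a) ◁ eqToHom ((congrArg K.obj (map_one T.i)).trans K.obj_one).symm ≫
        (K.Γ' (map_mul T.i a 1).symm).hom ≫ eqToHom (congrArg (fun a => K.obj (T.i a)) (mul_one a))
    rw [K.Γ'_trans _ (congrArg T.i (mul_one a)),
      K.Γ'_right_unit (map_one T.i)]
    simp

theorem TypeData.sig_isEquivalent :
    (Sig.monAbGpd D (T.cocycle K)).IsEquivalent ⟨G, T⟩ :=
  MonAbGpdOfType.isEquivalent_of_isOfType (S := Sig.monAbGpd D (T.cocycle K)) (T := ⟨G, T⟩)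
    (T.realize K) (hF := (T.realizeCoreMonoidal K).toMonoidal) (T.realize_isOfType K)

end realization

/-! ### Transport of monoidal functors along equivalences of type `(1, 1)`. -/

section conjugation

variable {G₁ G₂ : Type u} [Category.{v} G₁] [MonoidalCategory G₁] [Category.{v} G₂]
  [MonoidalCategory G₂] {G₁' G₂' : Type u'} [Category.{v'} G₁'] [MonoidalCategory G₁']
  [Category.{v'} G₂'] [MonoidalCategory G₂']
  {M : Type u} [Monoid M] {D : DModule.{u, v} M}
  {M' : Type u'} [Monoid M'] {D' : DModule.{u', v'} M'}
  {T₁ : TypeData G₁ D} {T₂ : TypeData G₂ D} {T₁' : TypeData G₁' D'} {T₂' : TypeData G₂' D'}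
  {p : M →* M'} {q : DModule.Hom D (D'.comap p)}

/-- Conjugation by equivalences and then by their inverses is isomorphic to the identity. -/
def conjIso (e : G₁ ≌ G₂) (e' : G₁' ≌ G₂') (F : G₁ ⥤ G₁') :
    e.functor ⋙ (e.inverse ⋙ F ⋙ e'.functor) ⋙ e'.inverse ≅ F :=
  Functor.isoWhiskerLeft e.functor (Functor.associator e.inverse (F ⋙ e'.functor) e'.inverse) ≪≫
    (Functor.associator e.functor e.inverse ((F ⋙ e'.functor) ⋙ e'.inverse)).symm ≪≫
    Functor.isoWhiskerRight e.unitIso.symm ((F ⋙ e'.functor) ⋙ e'.inverse) ≪≫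
    Functor.leftUnitor _ ≪≫ Functor.associator F e'.functor e'.inverse ≪≫
    Functor.isoWhiskerLeft F e'.unitIso.symm ≪≫ Functor.rightUnitor F

/-- The factors are associators, unitors and whiskered inverse units, all monoidal because `e` and
`e'` are monoidal equivalences. -/
theorem conjIso_isMonoidal (e : G₁ ≌ G₂) [e.functor.Monoidal] [e.inverse.Monoidal]
    [e.IsMonoidal] (e' : G₁' ≌ G₂') [e'.functor.Monoidal] [e'.inverse.Monoidal] [e'.IsMonoidal]
    (F : G₁ ⥤ G₁') [F.Monoidal] : NatTrans.IsMonoidal (conjIso e e' F).hom := by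
  have : NatTrans.IsMonoidal e.unitIso.hom := inferInstanceAs (NatTrans.IsMonoidal e.unit)
  have : NatTrans.IsMonoidal e'.unitIso.hom := inferInstanceAs (NatTrans.IsMonoidal e'.unit)
  have : NatTrans.IsMonoidal
      (Functor.associator e.functor e.inverse ((F ⋙ e'.functor) ⋙ e'.inverse)).inv := inferInstance
  exact inferInstanceAs (NatTrans.IsMonoidal
    (Functor.whiskerLeft e.functor
      (Functor.associator e.inverse (F ⋙ e'.functor) e'.inverse).hom ≫
    (Functor.associator e.functor e.inverse ((F ⋙ e'.functor) ⋙ e'.inverse)).inv ≫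
    Functor.whiskerRight e.unitIso.inv ((F ⋙ e'.functor) ⋙ e'.inverse) ≫
    (Functor.leftUnitor ((F ⋙ e'.functor) ⋙ e'.inverse)).hom ≫
    (Functor.associator F e'.functor e'.inverse).hom ≫
    Functor.whiskerLeft F e'.unitIso.inv ≫ (Functor.rightUnitor F).hom))

/-- Transport of monoidal functors along functors of type `(1, 1)`. -/
def MonFunctor.conj (E : G₂ ⥤ G₁) [E.Monoidal]
    (hE : IsOfType T₂ T₁ (MonoidHom.id M) (fun a => MonoidHom.id (D.A a)) E)
    (E' : G₁' ⥤ G₂') [E'.Monoidal]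
    (hE' : IsOfType T₁' T₂' (MonoidHom.id M') (fun a => MonoidHom.id (D'.A a)) E')
    (F : MonFunctor T₁ T₁' p q) : MonFunctor T₂ T₂' p q where
  F := E ⋙ F.F ⋙ E'
  isOfType := hE.comp (F.isOfType.comp hE')

theorem MonFunctor.conj_equiv (E : G₂ ⥤ G₁) [E.Monoidal]
    (hE : IsOfType T₂ T₁ (MonoidHom.id M) (fun a => MonoidHom.id (D.A a)) E)
    (E' : G₁' ⥤ G₂') [E'.Monoidal]
    (hE' : IsOfType T₁' T₂' (MonoidHom.id M') (fun a => MonoidHom.id (D'.A a)) E')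
    {F F' : MonFunctor T₁ T₁' p q} (h : F ≈ F') : F.conj E hE E' hE' ≈ F'.conj E hE E' hE' := by
  obtain ⟨e, he⟩ := h
  exact ⟨Functor.isoWhiskerLeft E (Functor.isoWhiskerRight e E'),
    inferInstanceAs (NatTrans.IsMonoidal (Functor.whiskerLeft E (Functor.whiskerRight e.hom E')))⟩

theorem MonFunctor.conj_conj_equiv (e : G₁ ≌ G₂) [e.functor.Monoidal] [e.inverse.Monoidal]
    [e.IsMonoidal] (e' : G₁' ≌ G₂') [e'.functor.Monoidal] [e'.inverse.Monoidal] [e'.IsMonoidal]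
    (h : IsOfType T₁ T₂ (MonoidHom.id M) (fun a => MonoidHom.id (D.A a)) e.functor)
    (h₁ : IsOfType T₂ T₁ (MonoidHom.id M) (fun a => MonoidHom.id (D.A a)) e.inverse)
    (h' : IsOfType T₁' T₂' (MonoidHom.id M') (fun a => MonoidHom.id (D'.A a)) e'.functor)
    (h₁' : IsOfType T₂' T₁' (MonoidHom.id M') (fun a => MonoidHom.id (D'.A a)) e'.inverse)
    (F : MonFunctor T₁ T₁' p q) :
    (F.conj e.inverse h₁ e'.functor h').conj e.functor h e'.inverse h₁' ≈ F := by
  exact ⟨conjIso e e' F.F, conjIso_isMonoidal e e' F.F⟩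

/-- The claim may be checked after applying the faithful functor `e.functor`, where it says that `j`
is compatible with the counit. -/
theorem IsOfType.inverse {e : G₁ ≌ G₂}
    (h : IsOfType T₁ T₂ (MonoidHom.id M) (fun a => MonoidHom.id (D.A a)) e.functor) :
    IsOfType T₂ T₁ (MonoidHom.id M) (fun a => MonoidHom.id (D.A a)) e.inverse := fun a Y hY => by
  obtain ⟨b, hb⟩ := T₁.i.surjective (toSkeleton (e.inverse.obj Y))
  have hab : T₂.i b = T₂.i a := (h b _ hb.symm).1.symm.trans
    ((congr_toSkeleton_of_iso (e.counitIso.app Y)).trans hY)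
  have hX : toSkeleton (e.inverse.obj Y) = T₁.i a := by
    rw [← hb, T₂.i.injective hab]
  obtain ⟨h', hj⟩ := h a _ hX
  refine ⟨hX, fun g => e.functor.map_injective ?_⟩
  rw [Equivalence.fun_inv_map]
  exact (hj g).symm.trans (T₂.j_conj hY h' (e.counitIso.app Y).symm g)

/-- Equivalences of type `(1, 1)` induce bijections on isomorphism classes of monoidal functors. -/
def MonFunctor.classesEquiv (e : G₁ ≌ G₂) [e.functor.Monoidal] [e.inverse.Monoidal]
    [e.IsMonoidal] (e' : G₁' ≌ G₂') [e'.functor.Monoidal] [e'.inverse.Monoidal] [e'.IsMonoidal]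
    (h : IsOfType T₁ T₂ (MonoidHom.id M) (fun a => MonoidHom.id (D.A a)) e.functor)
    (h' : IsOfType T₁' T₂' (MonoidHom.id M') (fun a => MonoidHom.id (D'.A a)) e'.functor)
    (p : M →* M') (q : DModule.Hom D (D'.comap p)) :
    Quotient (MonFunctor.setoid T₁ T₁' p q) ≃ Quotient (MonFunctor.setoid T₂ T₂' p q) where
  toFun := Quotient.map (MonFunctor.conj e.inverse h.inverse e'.functor h')
    fun _ _ => conj_equiv _ _ _ _
  invFun := Quotient.map (MonFunctor.conj e.functor h e'.inverse h'.inverse)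
    fun _ _ => conj_equiv _ _ _ _
  left_inv x := Quotient.inductionOn x fun F =>
    Quotient.sound (conj_conj_equiv e e' h h.inverse h' h'.inverse F)
  right_inv x := Quotient.inductionOn x fun F =>
    Quotient.sound (conj_conj_equiv e.symm e'.symm h.inverse h h'.inverse h' F)

end conjugation

/-! ### Classification by the third cohomology group. -/

section classification

variable {M : Type u} [Monoid M] {D : DModule.{u, v} M}
  {M' : Type u'} [Monoid M'] {D' : DModule.{u', v'} M'}
  {p : M →* M'} {q : DModule.Hom D (D'.comap p)}

/-- The two classes agree exactly when `(p^* l')⁻¹ · q_* l` is some `∂²φ` with `φ` normalized, which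
is what a tensorator provides. -/
theorem Sig.exists_tensorators_iff {l : D.Z₃} {l' : D'.Z₃} :
    (tensorators l l' p q).Nonempty ↔
      DModule.H₃.comap D' p (QuotientGroup.mk l') = DModule.H₃.map q (QuotientGroup.mk l) := by
  refine Iff.trans ?_ QuotientGroup.eq.symm
  rw [Subgroup.mem_subgroupOf]
  constructor
  · rintro ⟨φ, h1, h2⟩
    exact ⟨φ, h1, eq_inv_mul_of_mul_eq h2.symm⟩
  · rintro ⟨φ, h1, h2⟩
    exact ⟨φ, h1, (mul_eq_of_eq_inv_mul h2).symm⟩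

theorem Sig.nonempty_monFunctor_iff {l : D.Z₃} {l' : D'.Z₃} :
    Nonempty (MonFunctor (typeData D l) (typeData D' l') p q) ↔
      DModule.H₃.comap D' p (QuotientGroup.mk l') = DModule.H₃.map q (QuotientGroup.mk l) := by
  rw [← exists_tensorators_iff]
  constructor
  · rintro ⟨F⟩
    obtain ⟨φ, hφ, -⟩ := exists_equiv_monFunctor F
    exact ⟨φ, hφ⟩
  · rintro ⟨φ, hφ⟩
    exact ⟨monFunctor hφ⟩

/-- The identity morphism of a module, with target the restriction along the identity. -/
def DModule.idHom (D : DModule.{u, v} M) : DModule.Hom D (D.comap (MonoidHom.id M)) where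
  app a := MonoidHom.id (D.A a)
  app_push _ _ _ := rfl
  app_pull _ _ _ := rfl

theorem DModule.H₃.comap_id (x : D.H₃) :
    DModule.H₃.comap D (MonoidHom.id M) x = DModule.H₃.map D.idHom x := by
  induction x using QuotientGroup.induction_on
  rfl

theorem DModule.H₃.map_idHom_injective : Function.Injective (DModule.H₃.map D.idHom) := by
  have h : ∀ x, DModule.H₃.map D.idHom x = x := fun x => by
    induction x using QuotientGroup.induction_on
    rfl
  exact fun x y hxy => (h x).symm.trans (hxy.trans (h y))

/-- An equivalence of type `(1, 1)` amounts to a monoidal functor of that type, so the existence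
criterion applies with `p = 1` and `q = 1`. -/
theorem Sig.isEquivalent_iff {l l' : D.Z₃} :
    (monAbGpd D l).IsEquivalent (monAbGpd D l') ↔
      (QuotientGroup.mk l : D.H₃) = QuotientGroup.mk l' := by
  have h : Nonempty (MonFunctor (typeData D l) (typeData D l') (MonoidHom.id M) D.idHom) ↔ _ :=
    Sig.nonempty_monFunctor_iff
  rw [DModule.H₃.comap_id, DModule.H₃.map_idHom_injective.eq_iff, eq_comm] at h
  rw [← h]
  constructor
  · rintro ⟨e, he, -, -, ht⟩
    exact ⟨@MonFunctor.mk _ _ _ _ _ _ _ _ _ _ _ _ _ _ _ _ e.functor he ht⟩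
  · rintro ⟨F⟩
    exact MonAbGpdOfType.isEquivalent_of_isOfType (S := monAbGpd D l) (T := monAbGpd D l')
      F.F (hF := F.monoidal) F.isOfType

/-- Both groupoids may be replaced by those of their cocycles. Since the cleavages are arbitrary,
this contains invariance, injectivity and, for `S = T`, independence of the cleavage. -/
theorem MonAbGpdOfType.isEquivalent_iff {S T : MonAbGpdOfType D} (K : Cleavage S.carrier)
    (L : Cleavage T.carrier) : S.IsEquivalent T ↔ S.type.c K = T.type.c L := by
  have hS : Sig.monAbGpd D (S.type.cocycle K) ≈ S := S.type.sig_isEquivalent K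
  have hT : Sig.monAbGpd D (T.type.cocycle L) ≈ T := T.type.sig_isEquivalent L
  rw [TypeData.c_eq, TypeData.c_eq, ← Sig.isEquivalent_iff]
  exact ⟨fun h => Setoid.trans hS (Setoid.trans h (Setoid.symm hT)),
    fun h => Setoid.trans (Setoid.symm hS) (Setoid.trans h hT)⟩

/-- No cocycle is computed: `Sig D l` is equivalent to the groupoid of its own cocycle, and
equivalent cocycle groupoids have cohomologous cocycles. -/
theorem Sig.c_eq (l : D.Z₃) (K : Cleavage (Sig D l)) :
    (typeData D l).c K = QuotientGroup.mk l :=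
  Sig.isEquivalent_iff.1 ((typeData D l).sig_isEquivalent K)

theorem exists_classes_equiv (D : DModule.{u, v} M) : ∃ e : MonAbGpdClasses D ≃ D.H₃,
    (∀ (S : MonAbGpdOfType D) (K : Cleavage S.carrier), e ⟦S⟧ = S.type.c K) ∧
    (∀ l : D.Z₃, e.symm (QuotientGroup.mk l) = ⟦Sig.monAbGpd D l⟧) := by
  let K : ∀ S : MonAbGpdOfType D, Cleavage S.carrier := fun S => Classical.arbitrary _
  let f : MonAbGpdClasses D → D.H₃ := Quotient.lift (fun S => S.type.c (K S))
    fun S T h => (MonAbGpdOfType.isEquivalent_iff _ _).1 h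
  have hf : Function.Bijective f := by
    constructor
    · intro x y
      induction x, y using Quotient.inductionOn₂
      exact fun h => Quotient.sound ((MonAbGpdOfType.isEquivalent_iff _ _).2 h)
    · intro x
      induction x using QuotientGroup.induction_on with
      | H l => exact ⟨⟦Sig.monAbGpd D l⟧, Sig.c_eq l _⟩
  refine ⟨Equiv.ofBijective f hf, fun S L => ?_, fun l => ?_⟩
  -- Reflexivity of equivalence compares the cleavage fixed in `K` with the given `L`.
  · exact (MonAbGpdOfType.isEquivalent_iff _ _).1 (Setoid.refl S)
  · rw [Equiv.symm_apply_eq]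
    exact (Sig.c_eq l _).symm

end classification

/-! ### Classification of monoidal functors by the second cohomology group. -/

section functors

variable {G : Type u} [Category.{v} G] [MonoidalCategory G] [IsAbelianGroupoid G]
  {G' : Type u'} [Category.{v'} G'] [MonoidalCategory G'] [IsAbelianGroupoid G']
  {M : Type u} [Monoid M] {D : DModule.{u, v} M}
  {M' : Type u'} [Monoid M'] {D' : DModule.{u', v'} M'}

/-- The isomorphism classes of monoidal functors of type `(p, q)` between `G` and `G'` correspond to
those between the groupoids of the cocycles of `G` and `G'`. -/
theorem nonempty_classes_equiv (T : TypeData G D) (T' : TypeData G' D') (K : Cleavage G)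
    (K' : Cleavage G') (p : M →* M') (q : DModule.Hom D (D'.comap p)) :
    Nonempty (Quotient (MonFunctor.setoid (Sig.typeData D (T.cocycle K))
      (Sig.typeData D' (T'.cocycle K')) p q) ≃ Quotient (MonFunctor.setoid T T' p q)) := by
  have hS := T.sig_isEquivalent K
  have hS' := T'.sig_isEquivalent K'
  obtain ⟨e, _, _, _, h⟩ := hS
  obtain ⟨e', _, _, _, h'⟩ := hS'
  exact ⟨MonFunctor.classesEquiv e e' h h' p q⟩

/-- A given functor provides a base point `φ`; the tensorators are the products `φ · z` with `z` a
2-cocycle, and two of them give isomorphic functors exactly when the cocycles differ by a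
coboundary. -/
theorem Sig.classes_equiv {l : D.Z₃} {l' : D'.Z₃} {p : M →* M'} {q : DModule.Hom D (D'.comap p)}
    (h : Nonempty (MonFunctor (typeData D l) (typeData D' l') p q)) :
    Nonempty (Quotient (MonFunctor.setoid (typeData D l) (typeData D' l') p q) ≃
      (D'.comap p).H₂) := by
  obtain ⟨F⟩ := h
  obtain ⟨φ, hφ, -⟩ := exists_equiv_monFunctor F
  have hz : ∀ z : (D'.comap p).Z₂, φ * z.1 ∈ tensorators l l' p q := fun z =>
    ⟨mul_mem hφ.1 z.2.1, by rw [map_mul, (MonoidHom.mem_ker.1 z.2.2), mul_one]; exact hφ.2⟩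
  have key : ∀ z w : (D'.comap p).Z₂, monFunctor (hz z) ≈ monFunctor (hz w) ↔
      (QuotientGroup.mk z : (D'.comap p).H₂) = QuotientGroup.mk w := fun z w => by
    rw [monFunctor_equiv_iff, eq_comm, QuotientGroup.eq, Subgroup.mem_subgroupOf]
    have : (φ * w.1)⁻¹ * (φ * z.1) = w.1⁻¹ * z.1 := by group
    rw [this]
    rfl
  let f : (D'.comap p).H₂ →
      Quotient (MonFunctor.setoid (typeData D l) (typeData D' l') p q) :=
    Quotient.lift (fun z => ⟦monFunctor (hz z)⟧)
      fun z w h => Quotient.sound ((key z w).2 (Quotient.sound h))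
  refine ⟨(Equiv.ofBijective f ⟨fun x y => ?_, fun x => ?_⟩).symm⟩
  · induction x, y using Quotient.inductionOn₂
    exact fun h => (key _ _).1 (Quotient.exact h)
  · induction x using Quotient.inductionOn with
    | h L =>
      obtain ⟨ψ, hψ, hL⟩ := exists_equiv_monFunctor L
      -- Both cochains have the coboundary `(p^* l')⁻¹ · q_* l`, so their quotient is a cocycle.
      have hmem : φ⁻¹ * ψ ∈ (D'.comap p).Z₂ := ⟨(D'.comap p).C₂.mul_mem ((D'.comap p).C₂.inv_mem hφ.1) hψ.1, by
        have h1 := hφ.2.symm.trans hψ.2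
        rw [mul_right_inj] at h1
        change (D'.comap p).d₂ (φ⁻¹ * ψ) = 1
        rw [map_mul, map_inv, h1, inv_mul_cancel]⟩
      refine ⟨QuotientGroup.mk ⟨φ⁻¹ * ψ, hmem⟩, Quotient.sound (Setoid.trans ?_ (Setoid.symm hL))⟩
      rw [monFunctor_equiv_iff]
      simp [one_mem]

end functors

end Leech
open Leech

/-! ### The theorem. -/

theorem mainTheorem3 :
    -- (i) every monoidal abelian groupoid has a type
    (∀ (G : Type u) [Category.{v} G] [MonoidalCategory G] [IsAbelianGroupoid G],
      ∃ (M : Type u) (_ : Monoid M) (D : DModule.{u, v} M), Nonempty (TypeData G D)) ∧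
    -- (ii) the bijection `[G, i, j] ↦ c(G)`, with inverse induced by `l ↦ Σ(M, D, l)`
    (∀ (M : Type u) [Monoid M] (D : DModule.{u, v} M),
      ∃ e : MonAbGpdClasses D ≃ D.H₃,
        (∀ (S : MonAbGpdOfType D) (K : Cleavage S.carrier), e ⟦S⟧ = S.type.c K) ∧
        (∀ l : D.Z₃, e.symm (QuotientGroup.mk l) = ⟦Sig.monAbGpd D l⟧)) ∧
    -- (iii) every monoidal functor has a type
    (∀ (G : Type u) [Category.{v} G] [MonoidalCategory G] [IsAbelianGroupoid G]
      (G' : Type u') [Category.{v'} G'] [MonoidalCategory G'] [IsAbelianGroupoid G']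
      (M : Type u) [Monoid M] (D : DModule.{u, v} M)
      (M' : Type u') [Monoid M'] (D' : DModule.{u', v'} M')
      (T : TypeData G D) (T' : TypeData G' D') (F : G ⥤ G') [F.Monoidal],
      ∃ (p : M →* M') (q : DModule.Hom D (D'.comap p)), IsOfType T T' p q.app F) ∧
    -- (iv) existence and classification of the monoidal functors of a given type
    (∀ (G : Type u) [Category.{v} G] [MonoidalCategory G] [IsAbelianGroupoid G]
      (G' : Type u') [Category.{v'} G'] [MonoidalCategory G'] [IsAbelianGroupoid G']
      (M : Type u) [Monoid M] (D : DModule.{u, v} M)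
      (M' : Type u') [Monoid M'] (D' : DModule.{u', v'} M')
      (T : TypeData G D) (T' : TypeData G' D')
      (p : M →* M') (q : DModule.Hom D (D'.comap p)),
      (∀ (K : Cleavage G) (K' : Cleavage G'),
        Nonempty (MonFunctor T T' p q) ↔
          DModule.H₃.comap D' p (T'.c K') = DModule.H₃.map q (T.c K)) ∧
      (Nonempty (MonFunctor T T' p q) →
        Nonempty (Quotient (MonFunctor.setoid T T' p q) ≃ (D'.comap p).H₂))) := by
  refine ⟨fun G _ _ _ => ?_, fun M _ D => exists_classes_equiv D,
    fun G _ _ _ G' _ _ _ M _ D M' _ D' T T' F _ => exists_isOfType T T' F,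
    fun G _ _ _ G' _ _ _ M _ D M' _ D' T T' p q => ⟨fun K K' => ?_, fun h => ?_⟩⟩
  · let K : Cleavage G := Classical.arbitrary _
    exact ⟨Skeleton G, inferInstance, K.module, ⟨K.typeData⟩⟩
  -- Existence of a functor is nonemptiness of the set of isomorphism classes, which the bijection
  -- carries to the cocycle groupoids.
  · obtain ⟨e⟩ := nonempty_classes_equiv T T' K K' p q
    rw [TypeData.c_eq, TypeData.c_eq, ← Sig.nonempty_monFunctor_iff,
      ← nonempty_quotient_iff (MonFunctor.setoid T T' p q), ← e.nonempty_congr,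
      nonempty_quotient_iff]
  · let K : Cleavage G := Classical.arbitrary _
    let K' : Cleavage G' := Classical.arbitrary _
    obtain ⟨e⟩ := nonempty_classes_equiv T T' K K' p q
    have h' := (nonempty_quotient_iff (MonFunctor.setoid T T' p q)).2 h
    rw [← e.nonempty_congr, nonempty_quotient_iff] at h'
    obtain ⟨e'⟩ := Sig.classes_equiv h'
    exact ⟨e.symm.trans e'⟩
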